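/- **Setting.** Let $Z_i=(X_i,Y_i)$, $i=1,\dots,n$, be independent random elements of $\mathcal X\times\mathcal Y$, $\mathcal Y\subseteq\mathbb R$, on a probability space. Let $\mathbf F$ be a vector space of functions $f:\mathcal X\to\mathbb R$ with a (semi)norm $\|\cdot\|$, and for $f\in\mathbf F$ let $\rho_f(x,y)=\gamma(y,f(x))+c(f)$ be a loss, integrable at every $Z_i$ and such that $f\mapsto\rho_f(z)$ is convex for every $z$. Put $P_n\rho_f=\frac1n\sum_i\rho_f(Z_i)$ and $P\rho_f=\frac1n\sum_iE\rho_f(Z_i)$; the target $f^0$ minimizes $P\rho_f$ over $\mathbf F$, and $\Xi(f)=P\rho_f-P\rho_{f^0}$. Let $\psi_1,\dots,\psi_p\in\mathbf F$, $f_\beta=\sum_j\beta_j\psi_j$, let $\Phi\subseteq\mathbb R^p$ be convex, and let $\hat f=f_{\hat\beta}$ where $\hat\beta$ minimizes $P_n\rho_{f_\beta}+\lambda_1\|\beta\|_1+\lambda_2\|\beta\|_2^2$ over $\beta\in\Phi$. The target is linear: $f^0=f_{\beta^0}$ with $\beta^0\in\Phi$; let $S^0=\{j:\beta^0_j\ne0\}$.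 For a strictly convex $G:[0,\infty)\to\mathbb R$ with $G(0)=0$ let $H(v)=\sup_{u\ge0}\{uv-G(u)\}\in[0,\infty]$. Let $$\phi^2(S^0)=\min\Big\{\frac{\|f_\beta\|^2}{\|\beta_{S^0}\|_2^2}:\ \beta\ne0,\ \|\beta_{(S^0)^c}\|_1\le L_n\|\beta_{S^0}\|_2\Big\},\qquad L_n=3\Big(\sqrt{|S^0|}+\frac{2\lambda_2\|\beta^0\|_2}{\lambda_1}\Big),$$ where $\beta_S$ is $\beta$ with the coordinates outside $S$ set to zero (if $\beta^0=0$ the set is empty, the minimum is $+\infty$, and the argument of $H$ below is $0$). **Assumptions.** $p\ge2$, $\log p\le n$; for some $D>0$, $|\gamma(y,f_\beta(x))-\gamma(y,f_{\tilde\beta}(x))|\le D|f_\beta(x)-f_{\tilde\beta}(x)|$ for all $(x,y)\in\mathcal X\times\mathcal Y$ and $\beta,\tilde\beta\in\Phi$; $\frac1n\sum_i\max_jE\psi_j^2(X_i)\le1$; $\max_j\|\psi_j\|_\infty\le K$. With $\lambda_0=dD\sqrt{\log(p)/n}$, where $d>0$ is the constant of the statement, $\lambda_1\ge8\lambda_0$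 and $\lambda_2\ge0$. For some $\eta>0$, with $\mathbf F_{\rm local}=\{f\in\mathbf F:\|f-f^0\|_\infty\le\eta\}$: (1) $\Xi(f)\ge G(\|f-f^0\|)$ for all $f\in\mathbf F_{\rm local}$; (2) $f_\beta\in\mathbf F_{\rm local}$ for all $\beta\in\Phi$ with $\|\beta-\beta^0\|_1\le M^0:=\frac1{\lambda_0}H\Big(\frac{4\lambda_1\sqrt{|S^0|}+4\lambda_2\|\beta^0\|_2}{\phi(S^0)}\Big)$; (3) $\phi^2(S^0)>0$. **Claim.** For every $K>0$ there is a constant $d>0$, depending only on $K$, such that under these assumptions the following hold. a) With probability at least $1-1/p$, $$\Xi(\hat f)\le4H\Big(\frac{4\lambda_1\sqrt{|S^0|}+4\lambda_2\|\beta^0\|_2}{\phi(S^0)}\Big)\quad\text{and}\quad\|\hat\beta-\beta^0\|_1\le\frac4{\lambda_1}H\Big(\frac{4\lambda_1\sqrt{|S^0|}+4\lambda_2\|\beta^0\|_2}{\phi(S^0)}\Big).$$ b) If moreover $G(u)=cu^2$ for some $c>0$ (so that $H(v)=v^2/(4c)$), $\beta^0\ne0$, $\lambda_2=\frac{\lambda_1\sqrt{|S^0|}}{2\|\beta^0\|_2}$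 and $\lambda_1\le L\lambda_0$ for some $L\ge8$, then with probability at least $1-1/p$, $$\Xi(\hat f)\le\frac{36}c\frac{\lambda_1^2|S^0|}{\phi^2(S^0)}\le\frac{36}c\frac{(LdD)^2\log(p)|S^0|}{n\,\phi^2(S^0)},\qquad \|\hat\beta-\beta^0\|_1\le\frac{36}c\frac{\lambda_1|S^0|}{\phi^2(S^0)}\le\frac{36LdD}c\sqrt{\frac{\log p}n}\,\frac{|S^0|}{\phi^2(S^0)}.$$ -/

import Mathlib

open MeasureTheory ProbabilityTheory
open scoped ENNReal

noncomputable section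

namespace ElasticNet

/-! ### Vectors in `ℝ^p` -/

/-- The `ℓ₁`-norm. -/
def l1 {p : ℕ} (β : Fin p → ℝ) : ℝ := ∑ j, |β j|

/-- The `ℓ₂`-norm. -/
def l2 {p : ℕ} (β : Fin p → ℝ) : ℝ := √(∑ j, β j ^ 2)

/-- `β_S`: the coordinates outside `S` are replaced by zero. -/
def restr {p : ℕ} (S : Finset (Fin p)) (β : Fin p → ℝ) : Fin p → ℝ :=
  fun j => if j ∈ S then β j else 0

open Classical in
/-- `S_β`, the set of indices of the non-zero coefficients. -/
def supp {p : ℕ} (β : Fin p → ℝ) : Finset (Fin p) := Finset.univ.filter fun j => β j ≠ 0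

/-! ### The convex conjugate -/

/-- The convex conjugate `H(v) = sup_{u ≥ 0} (u v - G(u))`, which may be `+∞`. -/
def conj (G : ℝ → ℝ) (v : ℝ) : EReal :=
  ⨆ u : {u : ℝ // 0 ≤ u}, (((u : ℝ) * v - G u : ℝ) : EReal)

/-! ### Risks, target and estimator

`F` is a real vector space of functions `𝒳 → ℝ`, `ρ f : 𝒳 × 𝒴 → ℝ` is the loss function of
`f ∈ F`, and `Z 0, …, Z (n - 1)` is the sample, `Z i = (X i, Y i)`. -/

section Risk

variable {Ω 𝒳 : Type*} {𝒴 : Set ℝ} {n p : ℕ} {F : Submodule ℝ (𝒳 → ℝ)}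

/-- `f_β = ∑ j, β_j ψ_j`, as an element of `F`. -/
def lin (ψ : Fin p → F) (β : Fin p → ℝ) : F := ∑ j, β j • ψ j

/-- The empirical risk `P_n ρ_f = n⁻¹ ∑ i, ρ_f(Z_i)`. -/
def empRisk (ρ : F → 𝒳 × 𝒴 → ℝ) (Z : Fin n → Ω → 𝒳 × 𝒴) (f : F) (ω : Ω) : ℝ :=
  (1 / (n : ℝ)) * ∑ i, ρ f (Z i ω)

/-- The population risk `P ρ_f = n⁻¹ ∑ i, E ρ_f(Z_i)`. -/
def risk [MeasurableSpace Ω] (μ : Measure Ω) (ρ : F → 𝒳 × 𝒴 → ℝ) (Z : Fin n → Ω → 𝒳 × 𝒴)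
    (f : F) : ℝ :=
  (1 / (n : ℝ)) * ∑ i, ∫ ω, ρ f (Z i ω) ∂μ

/-- `f₀` is a target: it minimizes the population risk over `F`. -/
def IsTarget [MeasurableSpace Ω] (μ : Measure Ω) (ρ : F → 𝒳 × 𝒴 → ℝ) (Z : Fin n → Ω → 𝒳 × 𝒴)
    (f₀ : F) : Prop :=
  ∀ f : F, risk μ ρ Z f₀ ≤ risk μ ρ Z f

/-- The excess risk `Ξ(f) = P ρ_f - P ρ_{f₀}`. -/
def excess [MeasurableSpace Ω] (μ : Measure Ω) (ρ : F → 𝒳 × 𝒴 → ℝ) (Z : Fin n → Ω → 𝒳 × 𝒴)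
    (f₀ f : F) : ℝ :=
  risk μ ρ Z f - risk μ ρ Z f₀

/-- The elastic net criterion `P_n ρ_{f_β} + λ₁ ‖β‖₁ + λ₂ ‖β‖₂²`. -/
def criterion (ρ : F → 𝒳 × 𝒴 → ℝ) (Z : Fin n → Ω → 𝒳 × 𝒴) (ψ : Fin p → F) (lam₁ lam₂ : ℝ)
    (β : Fin p → ℝ) (ω : Ω) : ℝ :=
  empRisk ρ Z (lin ψ β) ω + lam₁ * l1 β + lam₂ * l2 β ^ 2

/-- `β` is an elastic net estimate over `Φ` for the sample at `ω`. -/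
def IsElasticNet (ρ : F → 𝒳 × 𝒴 → ℝ) (Z : Fin n → Ω → 𝒳 × 𝒴) (ψ : Fin p → F)
    (Φ : Set (Fin p → ℝ)) (lam₁ lam₂ : ℝ) (β : Fin p → ℝ) (ω : Ω) : Prop :=
  β ∈ Φ ∧ ∀ b ∈ Φ, criterion ρ Z ψ lam₁ lam₂ β ω ≤ criterion ρ Z ψ lam₁ lam₂ b ω

/-! ### The margin condition -/

/-- `F_local = {f ∈ F : ‖f - f₀‖_∞ ≤ η}`. -/
def localSet (f₀ : F) (η : ℝ) : Set F :=
  {f | ∀ x, |(f : 𝒳 → ℝ) x - (f₀ : 𝒳 → ℝ) x| ≤ η}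

/-- The margin condition: `Ξ(f) ≥ G(‖f - f₀‖)` on `F_local`, with `G` strictly convex on `[0, ∞)`
and `G(0) = 0`. The norm of `F` is a seminorm, so that the `L₂(P)`-norm on functions is covered. -/
def MarginCondition [MeasurableSpace Ω] (μ : Measure Ω) (ρ : F → 𝒳 × 𝒴 → ℝ)
    (Z : Fin n → Ω → 𝒳 × 𝒴) (N : Seminorm ℝ F) (f₀ : F) (η : ℝ) (G : ℝ → ℝ) : Prop :=
  StrictConvexOn ℝ (Set.Ici 0) G ∧ G 0 = 0 ∧
    ∀ f ∈ localSet f₀ η, G (N (f - f₀)) ≤ excess μ ρ Z f₀ f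

/-! ### The adaptive restricted eigenvalue -/

/-- `L_n = 3 (√|S| + 2 λ₂ ‖b_S‖₂ / λ₁)`, for a set `S` and a reference vector `b`. -/
def adaptiveL (lam₁ lam₂ : ℝ) (S : Finset (Fin p)) (b : Fin p → ℝ) : ℝ :=
  3 * (√(S.card : ℝ) + 2 * lam₂ * l2 (restr S b) / lam₁)

/-- The non-zero vectors `β` with `‖β_{Sᶜ}‖₁ ≤ L ‖β_S‖₂`. -/
def cone (S : Finset (Fin p)) (L : ℝ) : Set (Fin p → ℝ) :=
  {β | β ≠ 0 ∧ l1 (restr Sᶜ β) ≤ L * l2 (restr S β)}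

/-- `φ²(S)`, the minimum of `‖f_β‖² / ‖β_S‖₂²` over the cone. It is `+∞` when the cone is empty,
that is, when `S` is empty. -/
def phiSq (N : Seminorm ℝ F) (ψ : Fin p → F) (lam₁ lam₂ : ℝ) (S : Finset (Fin p))
    (b : Fin p → ℝ) : ℝ≥0∞ :=
  ⨅ β ∈ cone S (adaptiveL lam₁ lam₂ S b),
    ENNReal.ofReal (N (lin ψ β) ^ 2 / l2 (restr S β) ^ 2)

/-- `φ(S)` as a real number. For empty `S` the value is a dummy; there it only enters
`rateArg` below, where it divides zero. -/
def phi (N : Seminorm ℝ F) (ψ : Fin p → F) (lam₁ lam₂ : ℝ) (S : Finset (Fin p))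
    (b : Fin p → ℝ) : ℝ :=
  √(phiSq N ψ lam₁ lam₂ S b).toReal

/-- The argument `(4 λ₁ √s_β + 4 λ₂ ‖β‖₂) / φ(S_β)` of `H` in the estimation error. -/
def rateArg (N : Seminorm ℝ F) (ψ : Fin p → F) (lam₁ lam₂ : ℝ) (β : Fin p → ℝ) : ℝ :=
  (4 * lam₁ * √((supp β).card : ℝ) + 4 * lam₂ * l2 β) / phi N ψ lam₁ lam₂ (supp β) β

/-- `Δ = (3/2) Ξ(f_β) + H((4 λ₁ √s_β + 4 λ₂ ‖β‖₂) / φ(S_β))`, the oracle bound at `β`. -/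
def oracleBound [MeasurableSpace Ω] (μ : Measure Ω) (ρ : F → 𝒳 × 𝒴 → ℝ)
    (Z : Fin n → Ω → 𝒳 × 𝒴) (N : Seminorm ℝ F) (ψ : Fin p → F) (f₀ : F) (G : ℝ → ℝ)
    (lam₁ lam₂ : ℝ) (β : Fin p → ℝ) : EReal :=
  ((3 / 2 * excess μ ρ Z f₀ (lin ψ β) : ℝ) : EReal) + conj G (rateArg N ψ lam₁ lam₂ β)

/-- The functions `f_β` with `β ∈ Φ` and `‖β - b‖₁ ≤ M = Δ / λ₀` (where `Δ` is the oracle bound at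
`b`), and `f_b` itself, lie in `F_local`. -/
def LocalCondition [MeasurableSpace Ω] (μ : Measure Ω) (ρ : F → 𝒳 × 𝒴 → ℝ)
    (Z : Fin n → Ω → 𝒳 × 𝒴) (N : Seminorm ℝ F) (ψ : Fin p → F) (Φ : Set (Fin p → ℝ)) (f₀ : F)
    (η : ℝ) (G : ℝ → ℝ) (lam₀ lam₁ lam₂ : ℝ) (b : Fin p → ℝ) : Prop :=
  lin ψ b ∈ localSet f₀ η ∧
    ∀ β ∈ Φ, ((l1 (β - b) : ℝ) : EReal) ≤
        oracleBound μ ρ Z N ψ f₀ G lam₁ lam₂ b / ((lam₀ : ℝ) : EReal) →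
      lin ψ β ∈ localSet f₀ η

/-- The adaptive restricted eigenvalue condition `φ(S_b) > 0`. -/
def RestrictedEigenvalue (N : Seminorm ℝ F) (ψ : Fin p → F) (lam₁ lam₂ : ℝ)
    (b : Fin p → ℝ) : Prop :=
  0 < phiSq N ψ lam₁ lam₂ (supp b) b

end Risk

/-- `λ₀ = d D √(log p / n)`. -/
def lamZero (d D : ℝ) (n p : ℕ) : ℝ := d * D * √(Real.log p / n)

/-- The property `P` holds with probability at least `q`: it holds on a measurable event of
probability at least `q`. -/
def HoldsWithProb {Ω : Type*} [MeasurableSpace Ω] (μ : Measure Ω) (q : ℝ) (P : Ω → Prop) : Prop :=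
  ∃ A : Set Ω, MeasurableSet A ∧ q ≤ μ.real A ∧ ∀ ω ∈ A, P ω

end ElasticNet

end

open ElasticNet

/-! The argument is a deterministic convexity argument on the event where the centred empirical
process, over the part of Φ in an ℓ₁-ball of radius M about β⁰, is at most λ₀M. This is combined
with a proof that the event has probability at least 1 - 1/p when d = 5K.

Probability. The exponential moment of the process is bounded by removing the observations one at a
time (`integral_expMax_empirical_le`). Jensen's inequality and convexity of exp replace a centred
summand by a random sign times twice the loss difference. A one-sign contraction inequality
(`expMax_contraction`) then replaces that by a linear function of b - β⁰. What remains is a linear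
functional on an ℓ₁-ball, whose exponential is at most a sum of 2p exponentials, written as
hyperbolic cosines. Averaging such a cosine over a sign costs a factor exp(c²K²/2). Chernoff's bound
gives a sub-Gaussian tail for any finite index set, with no dependence on its size, so a countable
dense set and continuity of paths give the whole ball.

Determinism. Let E = λ₀M ≥ H. The basic inequality leaves a remainder q, a multiple of ‖δ_S‖₂, where
δ is the estimation error. If q < E/2, the bounds are immediate. Otherwise δ lies in the cone
defining φ, so 2q ≤ uv with u = ‖f_δ‖ and v the argument of H. The Fenchel inequality uv ≤ G(u) +
H(v) and the margin condition absorb q (`basic_inequality_consequence`). These steps need the error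
to lie in the ball; `oracle_inequality` obtains this by shrinking the estimator towards β⁰ and using
convexity of the criterion.

Part a) takes M = H/λ₀, or a sequence of radii tending to zero if H = 0. Part b) substitutes the
quadratic conjugate. -/

noncomputable section

namespace ElasticNet

/-! ### The exponential of a finite maximum -/

section ExpMax

variable {ι : Type*} [Fintype ι] [Nonempty ι]

/-- The exponential of the maximum of a finite family. -/
def expMax (x : ι → ℝ) : ℝ := Real.exp (Finset.univ.sup' Finset.univ_nonempty x)

lemma expMax_pos (x : ι → ℝ) : 0 < expMax x := Real.exp_pos _

lemma exp_le_expMax (x : ι → ℝ) (t : ι) : Real.exp (x t) ≤ expMax x :=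
  Real.exp_le_exp.2 (Finset.le_sup' x (Finset.mem_univ t))

lemma exists_expMax_eq (x : ι → ℝ) : ∃ t, expMax x = Real.exp (x t) := by
  obtain ⟨t, -, ht⟩ := Finset.exists_mem_eq_sup' (Finset.univ_nonempty (α := ι)) x
  exact ⟨t, by rw [expMax, ht]⟩

lemma expMax_le {x : ι → ℝ} {C : ℝ} (h : ∀ t, Real.exp (x t) ≤ C) : expMax x ≤ C := by
  obtain ⟨t, ht⟩ := exists_expMax_eq x
  exact ht ▸ h t

lemma continuous_expMax : Continuous (expMax : (ι → ℝ) → ℝ) :=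
  Real.continuous_exp.comp
    (Continuous.finset_sup'_apply _ fun t _ => continuous_apply t)

lemma measurable_expMax {α : Type*} [MeasurableSpace α] {X : α → ι → ℝ}
    (hX : ∀ t, Measurable fun z => X z t) : Measurable fun z => expMax (X z) :=
  continuous_expMax.measurable.comp (measurable_pi_iff.2 hX)

lemma integrable_expMax {α : Type*} [MeasurableSpace α] {μ : Measure α} [IsFiniteMeasure μ]
    {X : α → ι → ℝ} (hX : ∀ t, Measurable fun z => X z t) {C : ℝ} (hC : ∀ z t, |X z t| ≤ C) :
    Integrable (fun z => expMax (X z)) μ := by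
  refine Integrable.of_bound (measurable_expMax hX).aestronglyMeasurable (Real.exp C)
    (Filter.Eventually.of_forall fun z => ?_)
  rw [Real.norm_eq_abs, abs_of_pos (expMax_pos _)]
  exact expMax_le fun t => Real.exp_le_exp.2 ((le_abs_self _).trans (hC z t))

lemma exp_half_add_le (x y : ℝ) :
    Real.exp ((x + y) / 2) ≤ (Real.exp x + Real.exp y) / 2 := by
  have h1 : Real.exp ((x + y) / 2) = Real.exp (x / 2) * Real.exp (y / 2) := by
    rw [← Real.exp_add]; ring_nf
  have h2 : ∀ x : ℝ, Real.exp x = Real.exp (x / 2) ^ 2 := fun x => by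
    rw [← Real.exp_nat_mul]; congr 1; push_cast; ring
  rw [h1, h2 x, h2 y]
  nlinarith [sq_nonneg (Real.exp (x / 2) - Real.exp (y / 2))]

/-- Increments of the exponential are monotone in the starting point and in the length. -/
lemma exp_add_exp_le {A A' B B' : ℝ} (h1 : B' ≤ B) (h2 : B' ≤ A) (h3 : B - B' ≤ A' - A) :
    Real.exp A + Real.exp B ≤ Real.exp A' + Real.exp B' := by
  have e1 : Real.exp B = Real.exp B' * Real.exp (B - B') := by
    rw [← Real.exp_add]; ring_nf
  have e2 : Real.exp A' = Real.exp A * Real.exp (A' - A) := by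
    rw [← Real.exp_add]; ring_nf
  have h4 : Real.exp (B - B') ≤ Real.exp (A' - A) := Real.exp_le_exp.2 h3
  have h5 : Real.exp B' ≤ Real.exp A := Real.exp_le_exp.2 h2
  have h6 : 1 ≤ Real.exp (B - B') := Real.one_le_exp (by linarith)
  rw [e1, e2]
  nlinarith [Real.exp_pos B', Real.exp_pos A]

/-- The contraction inequality for one random sign. -/
lemma expMax_contraction (a g u : ι → ℝ) (h : ∀ s t, |g s - g t| ≤ |u s - u t|)
    (h0 : ∀ t, |g t| ≤ |u t|) :
    expMax (fun t => a t + g t) + expMax (fun t => a t - g t)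
      ≤ expMax (fun t => a t + u t) + expMax (fun t => a t - u t) := by
  obtain ⟨s, hs⟩ := exists_expMax_eq fun t => a t + g t
  obtain ⟨t, ht⟩ := exists_expMax_eq fun t => a t - g t
  have hs' : a t + g t ≤ a s + g s :=
    Real.exp_le_exp.1 (hs ▸ exp_le_expMax (fun t => a t + g t) t)
  have ht' : a s - g s ≤ a t - g t :=
    Real.exp_le_exp.1 (ht ▸ exp_le_expMax (fun t => a t - g t) s)
  have b1 := exp_le_expMax (fun t => a t + u t) s
  have b2 := exp_le_expMax (fun t => a t + u t) t
  have b3 := exp_le_expMax (fun t => a t - u t) s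
  have b4 := exp_le_expMax (fun t => a t - u t) t
  have hst := abs_le.1 (h s t)
  obtain ⟨s1, s2⟩ := abs_le.1 (h0 s)
  obtain ⟨t1, t2⟩ := abs_le.1 (h0 t)
  obtain ⟨c1, c2⟩ := hst
  rw [hs, ht]
  -- With opposite signs of u at s and t, |g| ≤ |u| bounds the two terms separately. With equal
  -- signs, the Lipschitz bound compares the two increments, and maximality of s or t orders their
  -- starting points.
  rcases le_total 0 (u s) with us | us <;> rcases le_total 0 (u t) with ut | ut
  · rw [abs_of_nonneg us] at s1 s2
    rw [abs_of_nonneg ut] at t1 t2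
    rcases le_total (u t) (u s) with hu | hu
    · rw [abs_of_nonneg (by linarith)] at c1 c2
      have := exp_add_exp_le (A := a s + g s) (A' := a s + u s) (B := a t - g t)
        (B' := a t - u t) (by linarith) (by linarith) (by linarith)
      linarith
    · rw [abs_of_nonpos (by linarith)] at c1 c2
      have := exp_add_exp_le (A := a t - g t) (A' := a t + u t) (B := a s + g s)
        (B' := a s - u s) (by linarith) (by linarith) (by linarith)
      linarith
  · rw [abs_of_nonneg us] at s1 s2
    rw [abs_of_nonpos ut] at t1 t2
    have e1 := Real.exp_le_exp.2 (show a s + g s ≤ a s + u s by linarith)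
    have e2 := Real.exp_le_exp.2 (show a t - g t ≤ a t - u t by linarith)
    linarith
  · rw [abs_of_nonpos us] at s1 s2
    rw [abs_of_nonneg ut] at t1 t2
    have e1 := Real.exp_le_exp.2 (show a s + g s ≤ a s - u s by linarith)
    have e2 := Real.exp_le_exp.2 (show a t - g t ≤ a t + u t by linarith)
    linarith
  · rw [abs_of_nonpos us] at s1 s2
    rw [abs_of_nonpos ut] at t1 t2
    rcases le_total (u t) (u s) with hu | hu
    · rw [abs_of_nonneg (by linarith)] at c1 c2
      have := exp_add_exp_le (A := a t - g t) (A' := a t - u t) (B := a s + g s)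
        (B' := a s + u s) (by linarith) (by linarith) (by linarith)
      linarith
    · rw [abs_of_nonpos (by linarith)] at c1 c2
      have := exp_add_exp_le (A := a s + g s) (A' := a s - u s) (B := a t - g t)
        (B' := a t + u t) (by linarith) (by linarith) (by linarith)
      linarith

/-! ### Symmetrization and contraction -/

section Coordinate

variable {S : Type*} [MeasurableSpace S]

/-- The mean of a bounded function. -/
lemma abs_integral_le_of_abs_le {P : Measure S} [IsProbabilityMeasure P] {f : S → ℝ} {B : ℝ}
    (h : ∀ z, |f z| ≤ B) : |∫ z, f z ∂P| ≤ B := by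
  simpa using norm_integral_le_of_norm_le_const (μ := P) (f := f)
    (Filter.Eventually.of_forall h)

/-- Jensen's inequality for the exponential. -/
lemma exp_integral_le {P : Measure S} [IsProbabilityMeasure P] {f : S → ℝ} (hf : Integrable f P)
    (he : Integrable (fun z => Real.exp (f z)) P) :
    Real.exp (∫ z, f z ∂P) ≤ ∫ z, Real.exp (f z) ∂P :=
  convexOn_exp.map_integral_le Real.continuous_exp.continuousOn isClosed_univ
    (by simp) hf he

/-- Symmetrization of a single observation. -/
lemma expMax_centered_le {P : Measure S} [IsProbabilityMeasure P] {g : ι → S → ℝ} {B : ℝ}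
    (hg : ∀ t, Measurable (g t)) (hB : ∀ t z, |g t z| ≤ B) (a : ι → ℝ) (z : S) :
    expMax (fun t => a t + (∫ y, g t y ∂P - g t z))
      ≤ ((∫ y, expMax (fun t => a t + 2 * g t y) ∂P) + expMax (fun t => a t - 2 * g t z)) / 2 := by
  obtain ⟨t, ht⟩ := exists_expMax_eq fun t => a t + (∫ y, g t y ∂P - g t z)
  have hgi : Integrable (g t) P := Integrable.of_bound (hg t).aestronglyMeasurable B
    (Filter.Eventually.of_forall fun y => hB t y)
  have hi : Integrable (fun y => expMax (fun t => a t + 2 * g t y)) P := by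
    refine integrable_expMax (C := (∑ t, |a t|) + 2 * B)
      (fun t => ((hg t).const_mul 2).const_add _) fun y t => ?_
    have h1 := Finset.single_le_sum (f := fun t => |a t|) (fun t _ => abs_nonneg _)
      (Finset.mem_univ t)
    have h2 := abs_add_le (a t) (2 * g t y)
    rw [abs_mul, abs_two] at h2
    linarith [hB t y]
  have h1 : ∫ y, (a t - g t z + g t y) ∂P = a t + (∫ y, g t y ∂P - g t z) := by
    rw [integral_add (integrable_const _) hgi]; simp; ring
  have he : Integrable (fun y => Real.exp (a t - g t z + g t y)) P := by
    refine Integrable.of_bound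
      (Real.measurable_exp.comp ((hg t).const_add _)).aestronglyMeasurable
      (Real.exp (a t - g t z + B)) (Filter.Eventually.of_forall fun y => ?_)
    rw [Real.norm_eq_abs, Real.abs_exp]
    exact Real.exp_le_exp.2 (by linarith [(abs_le.1 (hB t y)).2])
  rw [ht, ← h1]
  refine (exp_integral_le ((integrable_const _).add hgi) he).trans ?_
  have h2 : ∀ y, Real.exp (a t - g t z + g t y)
      ≤ (expMax (fun t => a t + 2 * g t y) + expMax (fun t => a t - 2 * g t z)) / 2 := by
    intro y
    -- Writing the exponent as a midpoint separates the ghost observation y from z, at the price of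
    -- doubling g.
    have e : a t - g t z + g t y = ((a t + 2 * g t y) + (a t - 2 * g t z)) / 2 := by ring
    rw [e]
    refine (exp_half_add_le _ _).trans ?_
    have := exp_le_expMax (fun t => a t + 2 * g t y) t
    have := exp_le_expMax (fun t => a t - 2 * g t z) t
    linarith
  refine (integral_mono he ((hi.add (integrable_const _)).div_const 2) h2).trans ?_
  simp only [Pi.add_apply]
  rw [integral_div, integral_add hi (integrable_const _)]
  simp

/-- Symmetrization and contraction for a single observation. -/
lemma integral_expMax_centered_le {P : Measure S} [IsProbabilityMeasure P] {g u : ι → S → ℝ}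
    {B U : ℝ} (hg : ∀ t, Measurable (g t)) (hB : ∀ t z, |g t z| ≤ B)
    (hu : ∀ t, Measurable (u t)) (hU : ∀ t z, |u t z| ≤ U)
    (h : ∀ s t z, |2 * g s z - 2 * g t z| ≤ |u s z - u t z|)
    (h0 : ∀ t z, |2 * g t z| ≤ |u t z|) (a : ι → ℝ) :
    ∫ z, expMax (fun t => a t + (∫ y, g t y ∂P - g t z)) ∂P
      ≤ ∫ z, (expMax (fun t => a t + u t z) + expMax (fun t => a t - u t z)) / 2 ∂P := by
  have key : ∀ {v : ι → S → ℝ} {V : ℝ}, (∀ t, Measurable (v t)) → (∀ t z, |v t z| ≤ V) →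
      Integrable (fun y => expMax (fun t => a t + v t y)) P := by
    intro v V hv hV
    refine integrable_expMax (C := (∑ t, |a t|) + V) (fun t => (hv t).const_add _) fun y t => ?_
    have h1 := Finset.single_le_sum (f := fun t => |a t|) (fun t _ => abs_nonneg _)
      (Finset.mem_univ t)
    have h2 := abs_add_le (a t) (v t y)
    linarith [hV t y]
  have i1 : Integrable (fun y => expMax (fun t => a t + 2 * g t y)) P :=
    key (V := 2 * B) (fun t => (hg t).const_mul 2) fun t z => by
      rw [abs_mul, abs_two]; linarith [hB t z]
  have i2 : Integrable (fun y => expMax (fun t => a t - 2 * g t y)) P := by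
    simpa only [sub_eq_add_neg] using key (v := fun t z => -(2 * g t z)) (V := 2 * B)
      (fun t => ((hg t).const_mul 2).neg) fun t z => by
        rw [abs_neg, abs_mul, abs_two]; linarith [hB t z]
  have i3 : Integrable (fun y => expMax (fun t => a t + u t y)) P := key hu hU
  have i4 : Integrable (fun y => expMax (fun t => a t - u t y)) P := by
    simpa only [sub_eq_add_neg] using key (v := fun t z => -u t z) (V := U)
      (fun t => (hu t).neg) fun t z => by rw [abs_neg]; exact hU t z
  have i5 : Integrable (fun z => expMax (fun t => a t + (∫ y, g t y ∂P - g t z))) P := by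
    refine key (v := fun t z => ∫ y, g t y ∂P - g t z) (V := B + B)
      (fun t => (hg t).const_sub _) fun t z => ?_
    have h1 : |∫ y, g t y ∂P| ≤ B := abs_integral_le_of_abs_le (hB t)
    have h2 := abs_sub (∫ y, g t y ∂P) (g t z)
    linarith [hB t z]
  calc
    _ ≤ ∫ z, ((∫ y, expMax (fun t => a t + 2 * g t y) ∂P)
          + expMax (fun t => a t - 2 * g t z)) / 2 ∂P :=
        integral_mono i5 (((integrable_const _).add i2).div_const 2)
          fun z => expMax_centered_le hg hB a z
    -- Since y and z have the same law, the two halves become the values of one random sign.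
    _ = ∫ z, (expMax (fun t => a t + 2 * g t z) + expMax (fun t => a t - 2 * g t z)) / 2 ∂P := by
        rw [integral_div, integral_div, integral_add (integrable_const _) i2, integral_add i1 i2]
        simp
    _ ≤ _ := by
        refine integral_mono ((i1.add i2).div_const 2) ((i3.add i4).div_const 2) fun z => ?_
        have := expMax_contraction a (fun t => 2 * g t z) (fun t => u t z)
          (fun s t => h s t z) (fun t => h0 t z)
        simp only at *
        linarith

end Coordinate

end ExpMax

/-! ### The exponential moment of the empirical process -/

section Moment

variable {S ι : Type*} [MeasurableSpace S] [Fintype ι] [Nonempty ι] {p : ℕ}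

lemma abs_sum_mul_le {b w : Fin p → ℝ} {K : ℝ} (hw : ∀ j, |w j| ≤ K) :
    |∑ j, b j * w j| ≤ l1 b * K := by
  refine (Finset.abs_sum_le_sum_abs _ _).trans ?_
  rw [l1, Finset.sum_mul]
  exact Finset.sum_le_sum fun j _ => by
    rw [abs_mul]; exact mul_le_mul_of_nonneg_left (hw j) (abs_nonneg _)

/-- Duality of ℓ₁ and ℓ∞ reduces the maximum to c · max |w j|. The cosine majorant is even and,
unlike the maximum, factorizes when averaged over a sign. -/
lemma expMax_linear_le [Nonempty (Fin p)] (b : ι → Fin p → ℝ) {c : ℝ} (hb : ∀ t, l1 (b t) ≤ c)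
    (w : Fin p → ℝ) :
    expMax (fun t => ∑ j, b t j * w j) ≤ ∑ j, 2 * Real.cosh (c * w j) := by
  refine expMax_le fun t => ?_
  obtain ⟨k, -, hk⟩ := Finset.exists_max_image Finset.univ (fun j => |w j|)
    Finset.univ_nonempty
  have hc : 0 ≤ c := (Finset.sum_nonneg fun j _ => abs_nonneg (b t j)).trans (hb t)
  have h1 : ∑ j, b t j * w j ≤ c * |w k| :=
    (le_abs_self _).trans ((abs_sum_mul_le fun j => hk j (Finset.mem_univ j)).trans
      (mul_le_mul_of_nonneg_right (hb t) (abs_nonneg _)))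
  have h2 : Real.exp (c * |w k|) ≤ 2 * Real.cosh (c * w k) := by
    have : Real.cosh (c * w k) = Real.cosh (c * |w k|) := by
      rw [← Real.cosh_abs, abs_mul, abs_of_nonneg hc]
    rw [this, Real.cosh_eq]
    linarith [Real.exp_pos (-(c * |w k|))]
  refine (Real.exp_le_exp.2 h1).trans (h2.trans ?_)
  exact Finset.single_le_sum (f := fun j => 2 * Real.cosh (c * w j))
    (fun j _ => by positivity) (Finset.mem_univ k)

/-- The average equals cosh(cw) cosh(cv), and cosh y ≤ exp(y²/2); this is the sub-Gaussian cost of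
one observation. -/
lemma cosh_add_cosh_sub_le {c K w v : ℝ} (hv : |v| ≤ K) :
    (Real.cosh (c * (w + v)) + Real.cosh (c * (w - v))) / 2
      ≤ Real.exp (c ^ 2 * K ^ 2 / 2) * Real.cosh (c * w) := by
  rw [mul_add, mul_sub, Real.cosh_add, Real.cosh_sub]
  have h1 := Real.cosh_le_exp_half_sq (c * v)
  have h2 : Real.exp ((c * v) ^ 2 / 2) ≤ Real.exp (c ^ 2 * K ^ 2 / 2) := by
    refine Real.exp_le_exp.2 ?_
    have : v ^ 2 ≤ K ^ 2 := sq_le_sq.2 (hv.trans (le_abs_self K))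
    rw [mul_pow]; gcongr
  nlinarith [Real.cosh_pos (c * w), mul_le_mul_of_nonneg_left (h1.trans h2)
    (Real.cosh_pos (c * w)).le]

/-- Exponential moment bound for the maximum of an empirical process whose increments are
contractions of a linear process. -/
theorem integral_expMax_empirical_le [Nonempty (Fin p)] (b : ι → Fin p → ℝ) {c K B : ℝ}
    (hb : ∀ t, l1 (b t) ≤ c) {ψ : Fin p → S → ℝ} (hψ : ∀ j, Measurable (ψ j))
    (hK : ∀ j z, |ψ j z| ≤ K) {g : ι → S → ℝ} (hg : ∀ t, Measurable (g t))
    (hB : ∀ t z, |g t z| ≤ B)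
    (h : ∀ s t z, |2 * g s z - 2 * g t z| ≤ |(∑ j, b s j * ψ j z) - ∑ j, b t j * ψ j z|)
    (h0 : ∀ t z, |2 * g t z| ≤ |∑ j, b t j * ψ j z|) (n : ℕ) :
    ∀ (P : Fin n → Measure S) [∀ i, IsProbabilityMeasure (P i)] (w : Fin p → ℝ),
      ∫ z, expMax (fun t => (∑ j, b t j * w j) + ∑ i, (∫ y, g t y ∂(P i) - g t (z i)))
          ∂(Measure.pi P)
        ≤ Real.exp (n * (c ^ 2 * K ^ 2 / 2)) * ∑ j, 2 * Real.cosh (c * w j) := by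
  -- Nonnegativity of K can fail only when the sample space is empty.
  have hK0 : 0 ≤ K ∨ IsEmpty S := by
    rcases isEmpty_or_nonempty S with hS | ⟨⟨z⟩⟩
    · exact Or.inr hS
    · exact Or.inl ((abs_nonneg _).trans (hK (Classical.arbitrary _) z))
  have hu : ∀ t, Measurable fun z => ∑ j, b t j * ψ j z := fun t =>
    Finset.measurable_sum _ fun j _ => (hψ j).const_mul _
  have hU : ∀ t z, |∑ j, b t j * ψ j z| ≤ c * K := fun t z =>
    (abs_sum_mul_le fun j => hK j z).trans (mul_le_mul_of_nonneg_right (hb t)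
      (hK0.resolve_right fun h => h.elim z))
  -- The vector w stores the signed feature vectors of the observations already removed, so the
  -- induction hypothesis is needed at every w.
  induction n with
  | zero =>
    intro P _ w
    simpa using expMax_linear_le b hb w
  | succ n ih =>
    intro P _ w
    have hE : ∀ t i, |∫ y, g t y ∂(P i)| ≤ B := fun t i =>
      abs_integral_le_of_abs_le (hB t)
    set Q : Measure (Fin n → S) := Measure.pi fun i => P i.succ
    let R : (Fin n → S) → ι → ℝ := fun r t => ∑ i, (∫ y, g t y ∂(P i.succ) - g t (r i))
    let lw : (Fin p → ℝ) → ι → ℝ := fun w t => ∑ j, b t j * w j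
    have hRm : ∀ t, Measurable fun r => R r t := fun t =>
      Finset.measurable_sum _ fun i _ => ((hg t).comp (measurable_pi_apply i)).const_sub _
    have hRb : ∀ r t, |R r t| ≤ n * (B + B) := by
      intro r t
      refine (Finset.abs_sum_le_sum_abs _ _).trans ?_
      refine (Finset.sum_le_card_nsmul _ _ (B + B) fun i _ => ?_).trans (by simp [mul_add])
      linarith [abs_sub (∫ y, g t y ∂(P i.succ)) (g t (r i)), hB t (r i), hE t i.succ]
    have hlw : ∀ w t, |lw w t| ≤ ∑ s, |lw w s| := fun w t =>
      Finset.single_le_sum (f := fun t => |lw w t|) (fun t _ => abs_nonneg _) (Finset.mem_univ t)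
    have hP : ∫ z, expMax (fun t => lw w t + ∑ i, (∫ y, g t y ∂(P i) - g t (z i))) ∂(Measure.pi P)
        = ∫ x : S × (Fin n → S),
            expMax (fun t => (lw w t + R x.2 t) + (∫ y, g t y ∂(P 0) - g t x.1))
            ∂((P 0).prod Q) := by
      have mp := measurePreserving_piFinSuccAbove P 0
      have := mp.integral_comp' (g := fun x : S × (Fin n → S) =>
        expMax (fun t => (lw w t + R x.2 t) + (∫ y, g t y ∂(P 0) - g t x.1)))
      simp only [Fin.succAbove_zero] at this
      rw [← this]
      refine integral_congr_ae (Filter.Eventually.of_forall fun z => ?_)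
      simp only [MeasurableEquiv.piFinSuccAbove]
      congr 1
      funext t
      rw [Fin.sum_univ_succ]
      simp only [R]
      simp [Fin.insertNthEquiv, Fin.tail]
      ring
    have I1 : Integrable (fun x : S × (Fin n → S) =>
        expMax (fun t => (lw w t + R x.2 t) + (∫ y, g t y ∂(P 0) - g t x.1))) ((P 0).prod Q) := by
      refine integrable_expMax (C := (∑ s, |lw w s|) + n * (B + B) + (B + B)) (fun t => ?_) ?_
      · exact (((hRm t).comp measurable_snd).const_add _).add
          (((hg t).comp measurable_fst).const_sub _)
      · intro x t
        have e1 := abs_add_le (lw w t + R x.2 t) (∫ y, g t y ∂(P 0) - g t x.1)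
        have e2 := abs_add_le (lw w t) (R x.2 t)
        have e3 := abs_sub (∫ y, g t y ∂(P 0)) (g t x.1)
        linarith [hlw w t, hRb x.2 t, hE t 0, hB t x.1]
    have I2 : ∀ σ : ℝ, |σ| = 1 → Integrable (fun x : S × (Fin n → S) =>
        expMax (fun t => (lw w t + R x.2 t) + σ * ∑ j, b t j * ψ j x.1)) ((P 0).prod Q) := by
      intro σ hσ
      refine integrable_expMax (C := (∑ s, |lw w s|) + n * (B + B) + c * K) (fun t => ?_) ?_
      · exact (((hRm t).comp measurable_snd).const_add _).add
          (((hu t).comp measurable_fst).const_mul _)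
      · intro x t
        have e1 := abs_add_le (lw w t + R x.2 t) (σ * ∑ j, b t j * ψ j x.1)
        have e2 := abs_add_le (lw w t) (R x.2 t)
        rw [abs_mul, hσ, one_mul] at e1
        linarith [hlw w t, hRb x.2 t, hU t x.1]
    have I3 : Integrable (fun x : S × (Fin n → S) =>
        (expMax (fun t => (lw w t + R x.2 t) + ∑ j, b t j * ψ j x.1)
          + expMax (fun t => (lw w t + R x.2 t) - ∑ j, b t j * ψ j x.1)) / 2) ((P 0).prod Q) := by
      have e1 := I2 1 (by simp)
      have e2 := I2 (-1) (by simp)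
      simp only [one_mul, neg_mul, ← sub_eq_add_neg] at e1 e2
      exact (e1.add e2).div_const 2
    have hcosh : ∀ x : S, ∫ r,
        (expMax (fun t => (lw w t + R r t) + ∑ j, b t j * ψ j x)
          + expMax (fun t => (lw w t + R r t) - ∑ j, b t j * ψ j x)) / 2 ∂Q
        ≤ Real.exp ((n + 1 : ℕ) * (c ^ 2 * K ^ 2 / 2)) * ∑ j, 2 * Real.cosh (c * w j) := by
      intro x
      have f1 : ∀ r t, (lw w t + R r t) + ∑ j, b t j * ψ j x
          = (∑ j, b t j * (w j + ψ j x)) + R r t := by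
        intro r t; simp only [lw, mul_add, Finset.sum_add_distrib]; ring
      have f2 : ∀ r t, (lw w t + R r t) - ∑ j, b t j * ψ j x
          = (∑ j, b t j * (w j - ψ j x)) + R r t := by
        intro r t; simp only [lw, mul_sub, Finset.sum_sub_distrib]; ring
      simp only [f1, f2]
      have J : ∀ v : Fin p → ℝ, Integrable (fun r =>
          expMax (fun t => (∑ j, b t j * v j) + R r t)) Q := by
        intro v
        refine integrable_expMax (C := (∑ s, |lw v s|) + n * (B + B))
          (fun t => (hRm t).const_add _) fun r t => ?_
        have e2 := abs_add_le (lw v t) (R r t)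
        linarith [hlw v t, hRb r t]
      rw [integral_div, integral_add (J _) (J _)]
      have g1 := ih (fun i => P i.succ) (fun j => w j + ψ j x)
      have g2 := ih (fun i => P i.succ) (fun j => w j - ψ j x)
      have g3 : ∑ j, (2 * Real.cosh (c * (w j + ψ j x)) + 2 * Real.cosh (c * (w j - ψ j x))) / 2
          ≤ Real.exp (c ^ 2 * K ^ 2 / 2) * ∑ j, 2 * Real.cosh (c * w j) := by
        rw [Finset.mul_sum]
        refine Finset.sum_le_sum fun j _ => ?_
        have := cosh_add_cosh_sub_le (c := c) (w := w j) (hK j x)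
        linarith
      rw [← Finset.sum_div, Finset.sum_add_distrib] at g3
      have g4 : Real.exp ((n + 1 : ℕ) * (c ^ 2 * K ^ 2 / 2))
          = Real.exp (n * (c ^ 2 * K ^ 2 / 2)) * Real.exp (c ^ 2 * K ^ 2 / 2) := by
        rw [← Real.exp_add]; push_cast; ring_nf
      rw [g4, mul_assoc]
      have g5 := mul_le_mul_of_nonneg_left g3 (Real.exp_pos (n * (c ^ 2 * K ^ 2 / 2))).le
      simp only [R]
      linarith
    change ∫ z, expMax (fun t => lw w t + ∑ i, (∫ y, g t y ∂(P i) - g t (z i))) ∂(Measure.pi P) ≤ _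
    -- The first observation is integrated with the others frozen in the offset. After contraction
    -- the order is swapped, and the induction hypothesis applies at w ± ψ(x).
    rw [hP, integral_prod_symm _ I1]
    calc
      _ ≤ ∫ r, ∫ x, (expMax (fun t => (lw w t + R r t) + ∑ j, b t j * ψ j x)
            + expMax (fun t => (lw w t + R r t) - ∑ j, b t j * ψ j x)) / 2 ∂(P 0) ∂Q := by
          refine integral_mono I1.integral_prod_right I3.integral_prod_right fun r => ?_
          exact integral_expMax_centered_le hg hB hu hU h h0 fun t => lw w t + R r t
      _ = ∫ x, ∫ r, (expMax (fun t => (lw w t + R r t) + ∑ j, b t j * ψ j x)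
            + expMax (fun t => (lw w t + R r t) - ∑ j, b t j * ψ j x)) / 2 ∂Q ∂(P 0) :=
          (integral_integral_swap I3).symm
      _ ≤ ∫ x, Real.exp ((n + 1 : ℕ) * (c ^ 2 * K ^ 2 / 2)) * ∑ j, 2 * Real.cosh (c * w j)
            ∂(P 0) :=
          integral_mono I3.integral_prod_left (integrable_const _) hcosh
      _ = _ := by simp

end Moment

/-! ### Deviations of the empirical process -/

section Deviation

variable {Ω S : Type*} [MeasurableSpace Ω] [MeasurableSpace S] {n p : ℕ}

lemma l1_nonneg (b : Fin p → ℝ) : 0 ≤ l1 b := Finset.sum_nonneg fun _ _ => abs_nonneg _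

lemma l1_smul (a : ℝ) (b : Fin p → ℝ) : l1 (a • b) = |a| * l1 b := by
  simp [l1, abs_mul, Finset.mul_sum]

lemma continuous_l1 : Continuous (l1 : (Fin p → ℝ) → ℝ) :=
  continuous_finsetSum _ fun j _ => (continuous_apply j).abs

/-- Chernoff's bound for the maximum of finitely many centered sums. -/
theorem measure_exists_sum_centered_gt_le {ι : Type*} [Fintype ι] [Nonempty ι]
    [Nonempty (Fin p)] {μ : Measure Ω} [IsProbabilityMeasure μ] {Z : Fin n → Ω → S}
    (hZ : ∀ i, Measurable (Z i)) (hind : iIndepFun Z μ) {b : ι → Fin p → ℝ} {D K M x : ℝ}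
    (hD : 0 < D) (hK : 0 < K) (hM : 0 < M) (hx : 0 < x) (hb : ∀ t, l1 (b t) ≤ M)
    {ψ : Fin p → S → ℝ} (hψ : ∀ j, Measurable (ψ j)) (hψK : ∀ j z, |ψ j z| ≤ K)
    {g : ι → S → ℝ} (hg : ∀ t, Measurable (g t))
    (h : ∀ s t z, |g s z - g t z| ≤ D * |(∑ j, b s j * ψ j z) - ∑ j, b t j * ψ j z|)
    (h0 : ∀ t z, |g t z| ≤ D * |∑ j, b t j * ψ j z|) :
    μ.real {ω | ∃ t, n * x < ∑ i, (∫ ω', g t (Z i ω') ∂μ - g t (Z i ω))}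
      ≤ 2 * p * Real.exp (-(n * x ^ 2 / (8 * (D * K * M) ^ 2))) := by
  -- This minimizes the Chernoff exponent 2nθ²(DKM)² - θnx.
  set θ : ℝ := x / (4 * (D * K * M) ^ 2) with hθ
  have hDKM : 0 < D * K * M := by positivity
  have hθ0 : 0 < θ := by positivity
  have hgB : ∀ t z, |g t z| ≤ D * (M * K) := fun t z => (h0 t z).trans <|
    mul_le_mul_of_nonneg_left ((abs_sum_mul_le fun j => hψK j z).trans
      (mul_le_mul_of_nonneg_right (hb t) hK.le)) hD.le
  have hscale : ∀ t z, ∑ j, (2 * θ * D) * b t j * ψ j z = 2 * θ * D * ∑ j, b t j * ψ j z := by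
    intro t z
    rw [Finset.mul_sum]
    exact Finset.sum_congr rfl fun j _ => by ring
  have hP : ∀ i, IsProbabilityMeasure (μ.map (Z i)) := fun i =>
    Measure.isProbabilityMeasure_map (hZ i).aemeasurable
  -- Scaling b by 2θD makes 2θg a contraction of the linear process. At w = 0 all the cosines equal
  -- 1, which leaves the factor 2p.
  have key := integral_expMax_empirical_le (fun t j => (2 * θ * D) * b t j)
    (c := 2 * θ * D * M) (K := K) (B := θ * (D * (M * K)))
    (fun t => by
      have := l1_smul (2 * θ * D) (b t)
      rw [abs_of_pos (by positivity)] at this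
      refine (le_of_eq this).trans (mul_le_mul_of_nonneg_left (hb t) (by positivity)))
    hψ hψK (g := fun t z => θ * g t z) (fun t => (hg t).const_mul θ)
    (fun t z => by
      rw [abs_mul, abs_of_pos hθ0]; exact mul_le_mul_of_nonneg_left (hgB t z) hθ0.le)
    (fun s t z => by
      rw [hscale, hscale, ← mul_sub, ← mul_sub, ← mul_sub, abs_mul, abs_mul, abs_mul, abs_two,
        abs_of_pos hθ0, abs_of_pos (show 0 < 2 * θ * D by positivity)]
      nlinarith [mul_le_mul_of_nonneg_left (h s t z) hθ0.le])
    (fun t z => by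
      rw [hscale, abs_mul, abs_mul, abs_mul, abs_two,
        abs_of_pos hθ0, abs_of_pos (show 0 < 2 * θ * D by positivity)]
      nlinarith [mul_le_mul_of_nonneg_left (h0 t z) hθ0.le])
    n (fun i => μ.map (Z i)) (fun _ => 0)
  set V : ι → Ω → ℝ := fun t ω => ∑ i, (∫ ω', g t (Z i ω') ∂μ - g t (Z i ω)) with hV
  have hVm : ∀ t, Measurable (V t) := fun t =>
    Finset.measurable_sum _ fun i _ => ((hg t).comp (hZ i)).const_sub _
  have hmean : ∀ t i, ∫ y, g t y ∂(μ.map (Z i)) = ∫ ω', g t (Z i ω') ∂μ := fun t i =>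
    integral_map (hZ i).aemeasurable (hg t).aestronglyMeasurable
  have hmap := (iIndepFun_iff_map_fun_eq_pi_map fun i => (hZ i).aemeasurable).1 hind
  have hint : ∫ ω, expMax (fun t => θ * V t ω) ∂μ
      ≤ Real.exp (n * ((2 * θ * D * M) ^ 2 * K ^ 2 / 2)) * (2 * p) := by
    rw [← hmap, integral_map (measurable_pi_lambda _ hZ).aemeasurable] at key
    · simpa [integral_const_mul, hmean, hV, Finset.mul_sum, mul_sub, mul_comm (p : ℝ)] using key
    · refine (measurable_expMax fun t => ?_).aestronglyMeasurable
      exact measurable_const.add (Finset.measurable_sum _ fun i _ =>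
        (((hg t).const_mul θ).comp (measurable_pi_apply i)).const_sub _)
  have hVb : ∀ ω t, |θ * V t ω| ≤ θ * (n * (D * (M * K) + D * (M * K))) := by
    intro ω t
    rw [abs_mul, abs_of_pos hθ0]
    refine mul_le_mul_of_nonneg_left ((Finset.abs_sum_le_sum_abs _ _).trans ?_) hθ0.le
    refine (Finset.sum_le_card_nsmul _ _ (D * (M * K) + D * (M * K)) fun i _ => ?_).trans
      (by simp [mul_add])
    have e1 := abs_sub (∫ ω', g t (Z i ω') ∂μ) (g t (Z i ω))
    have e2 : |∫ ω', g t (Z i ω') ∂μ| ≤ D * (M * K) :=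
      abs_integral_le_of_abs_le fun ω' => hgB t _
    linarith [hgB t (Z i ω)]
  have hmk := mul_meas_ge_le_integral_of_nonneg (μ := μ)
    (Filter.Eventually.of_forall fun ω => (expMax_pos fun t => θ * V t ω).le)
    (integrable_expMax (fun t => (hVm t).const_mul θ) hVb) (Real.exp (θ * (n * x)))
  have hsub : μ.real {ω | ∃ t, n * x < V t ω}
      ≤ μ.real {ω | Real.exp (θ * (n * x)) ≤ expMax fun t => θ * V t ω} := by
    refine measureReal_mono fun ω ⟨t, ht⟩ => ?_
    exact (Real.exp_le_exp.2 (mul_le_mul_of_nonneg_left ht.le hθ0.le)).trans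
      (exp_le_expMax (fun t => θ * V t ω) t)
  have hexp : Real.exp (n * ((2 * θ * D * M) ^ 2 * K ^ 2 / 2))
      = Real.exp (θ * (n * x)) * Real.exp (-(n * x ^ 2 / (8 * (D * K * M) ^ 2))) := by
    rw [← Real.exp_add]
    congr 1
    rw [hθ]
    field_simp
    ring
  rw [hexp] at hint
  have hpos := Real.exp_pos (θ * (n * x))
  have : Real.exp (θ * (n * x)) * μ.real {ω | ∃ t, n * x < V t ω}
      ≤ Real.exp (θ * (n * x)) * (2 * p * Real.exp (-(n * x ^ 2 / (8 * (D * K * M) ^ 2)))) := by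
    have := mul_le_mul_of_nonneg_left hsub hpos.le
    linarith
  exact le_of_mul_le_mul_left this hpos

/-- Uniform deviation bound over an `ℓ₁`-ball for Lipschitz functions of linear combinations. -/
theorem exists_event_sum_centered_le [Nonempty (Fin p)] {μ : Measure Ω} [IsProbabilityMeasure μ]
    {Z : Fin n → Ω → S} (hZ : ∀ i, Measurable (Z i)) (hind : iIndepFun Z μ)
    {D K M x : ℝ} (hD : 0 < D) (hK : 0 < K) (hM : 0 < M) (hx : 0 < x)
    {ψ : Fin p → S → ℝ} (hψ : ∀ j, Measurable (ψ j)) (hψK : ∀ j z, |ψ j z| ≤ K)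
    {Φ : Set (Fin p → ℝ)} {b₀ : Fin p → ℝ} (hb₀ : b₀ ∈ Φ)
    {g : (Fin p → ℝ) → S → ℝ} (hg : ∀ b, Measurable (g b)) (hg0 : ∀ z, g b₀ z = 0)
    (h : ∀ z, ∀ a ∈ Φ, ∀ b ∈ Φ, |g a z - g b z| ≤ D * |∑ j, (a - b) j * ψ j z|) :
    ∃ A : Set Ω, MeasurableSet A ∧
      1 - 2 * p * Real.exp (-(n * x ^ 2 / (8 * (D * K * M) ^ 2))) ≤ μ.real A ∧
      ∀ ω ∈ A, ∀ b ∈ Φ, l1 (b - b₀) ≤ M →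
        ∑ i, (∫ ω', g b (Z i ω') ∂μ - g b (Z i ω)) ≤ n * x := by
  set T : Set (Fin p → ℝ) := {b | b ∈ Φ ∧ l1 (b - b₀) ≤ M} with hT
  have : Nonempty T := ⟨⟨b₀, hb₀, by simp [l1, hM.le]⟩⟩
  set V : (Fin p → ℝ) → Ω → ℝ := fun b ω => ∑ i, (∫ ω', g b (Z i ω') ∂μ - g b (Z i ω)) with hV
  have hVm : ∀ b, Measurable (V b) := fun b =>
    Finset.measurable_sum _ fun i _ => ((hg b).comp (hZ i)).const_sub _
  have hlip : ∀ z, ∀ a ∈ Φ, ∀ b ∈ Φ, |g a z - g b z| ≤ D * (l1 (a - b) * K) :=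
    fun z a ha b hb => (h z a ha b hb).trans
      (mul_le_mul_of_nonneg_left (abs_sum_mul_le fun j => hψK j z) hD.le)
  have hgi : ∀ b ∈ Φ, ∀ i, Integrable (fun ω => g b (Z i ω)) μ := fun b hb i =>
    Integrable.of_bound ((hg b).comp (hZ i)).aestronglyMeasurable (D * (l1 (b - b₀) * K))
      (Filter.Eventually.of_forall fun ω => by
        simpa [hg0] using hlip (Z i ω) b hb b₀ hb₀)
  have hVlip : ∀ ω, ∀ a ∈ Φ, ∀ b ∈ Φ, |V a ω - V b ω| ≤ n * (2 * (D * (l1 (a - b) * K))) := by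
    intro ω a ha b hb
    simp only [hV]
    rw [← Finset.sum_sub_distrib]
    refine (Finset.abs_sum_le_sum_abs _ _).trans ?_
    refine (Finset.sum_le_card_nsmul _ _ (2 * (D * (l1 (a - b) * K))) fun i _ => ?_).trans
      (by simp)
    have e1 : |∫ ω', (g a (Z i ω') - g b (Z i ω')) ∂μ| ≤ D * (l1 (a - b) * K) :=
      abs_integral_le_of_abs_le fun ω' => hlip _ a ha b hb
    rw [integral_sub (hgi a ha i) (hgi b hb i)] at e1
    have e2 := hlip (Z i ω) a ha b hb
    have e3 := abs_sub (∫ ω', g a (Z i ω') ∂μ - ∫ ω', g b (Z i ω') ∂μ)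
      (g a (Z i ω) - g b (Z i ω))
    rw [show ∫ ω', g a (Z i ω') ∂μ - g a (Z i ω) - (∫ ω', g b (Z i ω') ∂μ - g b (Z i ω))
      = (∫ ω', g a (Z i ω') ∂μ - ∫ ω', g b (Z i ω') ∂μ) - (g a (Z i ω) - g b (Z i ω)) by ring]
    linarith
  have hcont : ∀ ω, Continuous fun b : T => V b ω := by
    intro ω
    refine continuous_iff_continuousAt.2 fun b => ?_
    refine tendsto_iff_norm_sub_tendsto_zero.2 ?_
    refine squeeze_zero (fun _ => norm_nonneg _)
      (fun a : T => hVlip ω a.1 a.2.1 b.1 b.2.1) ?_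
    have hc : Continuous fun a : T => (n : ℝ) * (2 * (D * (l1 (a.1 - b.1) * K))) :=
      continuous_const.mul (continuous_const.mul (continuous_const.mul
        ((continuous_l1.comp (continuous_subtype_val.sub continuous_const)).mul
          continuous_const)))
    simpa [l1] using hc.tendsto b
  -- Finite initial pieces of a dense sequence give decreasing events with a common lower
  -- probability bound; continuity from above handles their intersection.
  let q : ℕ → T := TopologicalSpace.denseSeq T
  let A : ℕ → Set Ω := fun N => {ω | ∀ k : Fin (N + 1), V (q k) ω ≤ n * x}
  have hAm : ∀ N, MeasurableSet (A N) := fun N => by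
    have : A N = ⋂ k : Fin (N + 1), {ω | V (q k) ω ≤ n * x} := by ext; simp [A]
    rw [this]
    exact MeasurableSet.iInter fun k => measurableSet_le (hVm _) measurable_const
  have hAanti : Antitone A := fun N N' hN ω hω k => hω ⟨k, by omega⟩
  have hAμ : ∀ N, 1 - 2 * p * Real.exp (-(n * x ^ 2 / (8 * (D * K * M) ^ 2))) ≤ μ.real (A N) := by
    intro N
    have hlin : ∀ (a b : Fin p → ℝ) z, (∑ j, (a - b₀) j * ψ j z) - ∑ j, (b - b₀) j * ψ j z
        = ∑ j, (a - b) j * ψ j z := fun a b z => by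
      rw [← Finset.sum_sub_distrib]
      exact Finset.sum_congr rfl fun j _ => by simp only [Pi.sub_apply]; ring
    have := measure_exists_sum_centered_gt_le (ι := Fin (N + 1)) hZ hind
      (b := fun k => (q k : Fin p → ℝ) - b₀) hD hK hM hx (fun k => (q k).2.2) hψ hψK
      (g := fun k => g (q k)) (fun k => hg _)
      (fun s t z => by
        rw [hlin]; exact h z _ (q s).2.1 _ (q t).2.1)
      (fun t z => by simpa [hg0] using h z _ (q t).2.1 _ hb₀)
    have hc : {ω | ∃ t : Fin (N + 1), n * x
        < ∑ i, (∫ ω', g (q t) (Z i ω') ∂μ - g (q t) (Z i ω))} = (A N)ᶜ := by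
      ext ω; simp only [A, hV, Set.mem_ofPred_eq, Set.mem_compl_iff, not_forall, not_le]
    rw [hc, probReal_compl_eq_one_sub (hAm N)] at this
    linarith
  refine ⟨⋂ N, A N, MeasurableSet.iInter hAm, ?_, ?_⟩
  · have ht := tendsto_measure_iInter_atTop (μ := μ) (fun N => (hAm N).nullMeasurableSet) hAanti
      ⟨0, measure_ne_top _ _⟩
    have ht' := (ENNReal.tendsto_toReal (measure_ne_top μ (⋂ N, A N))).comp ht
    exact ge_of_tendsto' ht' hAμ
  · intro ω hω b hb hbM
    refine (TopologicalSpace.denseRange_denseSeq T).induction_on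
      (p := fun b : T => V b ω ≤ n * x) ⟨b, hb, hbM⟩
      (isClosed_le (hcont ω) continuous_const) fun k => ?_
    exact Set.mem_iInter.1 hω k ⟨k, Nat.lt_succ_self k⟩

end Deviation

/-! ### Vectors restricted to the support -/

section Vectors

variable {p : ℕ}

lemma l2_nonneg (b : Fin p → ℝ) : 0 ≤ l2 b := Real.sqrt_nonneg _

lemma l2_sq (b : Fin p → ℝ) : l2 b ^ 2 = ∑ j, b j ^ 2 :=
  Real.sq_sqrt (Finset.sum_nonneg fun _ _ => sq_nonneg _)

lemma l1_restr (S : Finset (Fin p)) (b : Fin p → ℝ) : l1 (restr S b) = ∑ j ∈ S, |b j| := by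
  simp [l1, restr, apply_ite, Finset.sum_ite_mem]

lemma l2_restr_sq (S : Finset (Fin p)) (b : Fin p → ℝ) :
    l2 (restr S b) ^ 2 = ∑ j ∈ S, b j ^ 2 := by
  simp [l2_sq, restr, Finset.sum_ite_mem]

lemma l1_restr_add_compl (S : Finset (Fin p)) (b : Fin p → ℝ) :
    l1 (restr S b) + l1 (restr Sᶜ b) = l1 b := by
  rw [l1_restr, l1_restr, Finset.sum_add_sum_compl, l1]

lemma l1_restr_le (S : Finset (Fin p)) (b : Fin p → ℝ) :
    l1 (restr S b) ≤ √(S.card : ℝ) * l2 (restr S b) := by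
  refine abs_le_of_sq_le_sq' ?_ (mul_nonneg (Real.sqrt_nonneg _) (l2_nonneg _)) |>.2
  rw [mul_pow, Real.sq_sqrt (Nat.cast_nonneg _), l2_restr_sq, l1_restr]
  simpa using sq_sum_le_card_mul_sum_sq (s := S) (f := fun j => |b j|)

lemma mem_supp {b : Fin p → ℝ} {j : Fin p} : j ∈ supp b ↔ b j ≠ 0 := by simp [supp]

lemma restr_supp (b : Fin p → ℝ) : restr (supp b) b = b := by
  funext j
  by_cases h : b j = 0 <;> simp [restr, mem_supp, h]

/-- Off the support of b₀ the difference is b itself, so that part is exact; on the support this is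
the triangle inequality. -/
lemma l1_sub_l1_le (b b₀ : Fin p → ℝ) :
    l1 b₀ - l1 b ≤ l1 (restr (supp b₀) (b - b₀)) - l1 (restr (supp b₀)ᶜ (b - b₀)) := by
  have h0 : l1 b₀ = l1 (restr (supp b₀) b₀) := by rw [restr_supp]
  have h1 := l1_restr_add_compl (supp b₀) b
  have h2 : l1 (restr (supp b₀)ᶜ (b - b₀)) = l1 (restr (supp b₀)ᶜ b) := by
    rw [l1_restr, l1_restr]
    refine Finset.sum_congr rfl fun j hj => ?_
    have : b₀ j = 0 := by simpa [mem_supp] using hj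
    simp [this]
  have h3 : l1 (restr (supp b₀) b₀)
      ≤ l1 (restr (supp b₀) b) + l1 (restr (supp b₀) (b - b₀)) := by
    rw [l1_restr, l1_restr, l1_restr, ← Finset.sum_add_distrib]
    refine Finset.sum_le_sum fun j _ => ?_
    have := abs_sub (b j) (b j - b₀ j)
    simpa using this
  linarith

/-- A tangent to the square at b₀ lies below it, and its slope vanishes off the support;
Cauchy–Schwarz does the rest. -/
lemma l2_sq_sub_l2_sq_le (b b₀ : Fin p → ℝ) :
    l2 b₀ ^ 2 - l2 b ^ 2 ≤ 2 * (l2 b₀ * l2 (restr (supp b₀) (b - b₀))) := by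
  have h1 : ∑ j, -b₀ j * restr (supp b₀) (b - b₀) j
      ≤ l2 b₀ * l2 (restr (supp b₀) (b - b₀)) := by
    have := Real.sum_mul_le_sqrt_mul_sqrt Finset.univ (fun j => -b₀ j)
      (restr (supp b₀) (b - b₀))
    simpa [l2] using this
  have h2 : l2 b₀ ^ 2 - l2 b ^ 2 ≤ 2 * ∑ j, -b₀ j * restr (supp b₀) (b - b₀) j := by
    rw [l2_sq, l2_sq, ← Finset.sum_sub_distrib, Finset.mul_sum]
    refine Finset.sum_le_sum fun j _ => ?_
    by_cases h : b₀ j = 0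
    · simp [h, sq_nonneg]
    · simp only [restr, mem_supp, ne_eq, h, not_false_eq_true, if_true, Pi.sub_apply]
      nlinarith [sq_nonneg (b j - b₀ j)]
  linarith

end Vectors

/-! ### The oracle inequality on the event -/

section Oracle

variable {Ω 𝒳 : Type*} {𝒴 : Set ℝ} {n p : ℕ} {F : Submodule ℝ (𝒳 → ℝ)}

lemma lin_convexComb (ψ : Fin p → F) (s t : ℝ) (a b : Fin p → ℝ) :
    lin ψ (s • a + t • b) = s • lin ψ a + t • lin ψ b := by
  simp [lin, add_smul, mul_smul, Finset.sum_add_distrib, Finset.smul_sum]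

lemma lin_apply (ψ : Fin p → F) (b : Fin p → ℝ) (x : 𝒳) :
    (lin ψ b : 𝒳 → ℝ) x = ∑ j, b j * (ψ j : 𝒳 → ℝ) x := by
  simp [lin, Finset.sum_apply]

lemma lin_sub (ψ : Fin p → F) (a b : Fin p → ℝ) : lin ψ (a - b) = lin ψ a - lin ψ b := by
  refine Subtype.ext (funext fun x => ?_)
  change _ = (lin ψ a : 𝒳 → ℝ) x - (lin ψ b : 𝒳 → ℝ) x
  simp [lin_apply, sub_mul, Finset.sum_sub_distrib]

/-- On the cone, `φ(S) ‖β_S‖₂ ≤ ‖f_β‖`, and `φ(S) > 0`. -/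
lemma phi_pos_and_mul_le {N : Seminorm ℝ F} {ψ : Fin p → F} {lam₁ lam₂ : ℝ}
    {S : Finset (Fin p)} {b₀ b : Fin p → ℝ} (hpos : 0 < phiSq N ψ lam₁ lam₂ S b₀)
    (hb : b ∈ cone S (adaptiveL lam₁ lam₂ S b₀)) (hS : 0 < l2 (restr S b)) :
    0 < phi N ψ lam₁ lam₂ S b₀ ∧ phi N ψ lam₁ lam₂ S b₀ * l2 (restr S b) ≤ N (lin ψ b) := by
  have hle : phiSq N ψ lam₁ lam₂ S b₀
      ≤ ENNReal.ofReal (N (lin ψ b) ^ 2 / l2 (restr S b) ^ 2) := iInf₂_le b hb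
  -- A cone member makes the infimum finite, so `toReal` does not send ⊤ to zero.
  have htop : phiSq N ψ lam₁ lam₂ S b₀ ≠ ⊤ := ne_top_of_le_ne_top ENNReal.ofReal_ne_top hle
  refine ⟨Real.sqrt_pos.2 (ENNReal.toReal_pos hpos.ne' htop), ?_⟩
  have h1 : (phiSq N ψ lam₁ lam₂ S b₀).toReal ≤ N (lin ψ b) ^ 2 / l2 (restr S b) ^ 2 :=
    ENNReal.toReal_le_of_le_ofReal (by positivity) hle
  have h2 : phi N ψ lam₁ lam₂ S b₀ ≤ N (lin ψ b) / l2 (restr S b) := by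
    rw [phi, ← Real.sqrt_sq (div_nonneg (apply_nonneg N _) hS.le), div_pow]
    exact Real.sqrt_le_sqrt h1
  exact (le_div_iff₀ hS).1 h2

/-- The dichotomy behind the oracle inequality: from the basic inequality with remainder `E`. -/
lemma basic_inequality_consequence {N : Seminorm ℝ F} {ψ : Fin p → F} {G : ℝ → ℝ}
    {lam₁ lam₂ E Ξ : ℝ} {b₀ b : Fin p → ℝ} (hlam₁ : 0 < lam₁) (hlam₂ : 0 ≤ lam₂) (hE : 0 < E)
    (hΞ : 0 ≤ Ξ) (hpos : RestrictedEigenvalue N ψ lam₁ lam₂ b₀)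
    (hconj : conj G (rateArg N ψ lam₁ lam₂ b₀) ≤ (E : EReal))
    (hG : G (N (lin ψ b - lin ψ b₀)) ≤ Ξ)
    (hbasic : Ξ + lam₁ * l1 b + lam₂ * l2 b ^ 2 ≤ E + lam₁ * l1 b₀ + lam₂ * l2 b₀ ^ 2) :
    lam₁ * l1 (b - b₀) ≤ 2 * E ∧ Ξ ≤ 3 * E := by
  set S := supp b₀ with hS
  set δ := b - b₀ with hδ
  set s := √(S.card : ℝ) with hs
  have hs0 : 0 ≤ s := Real.sqrt_nonneg _
  have h1 := l1_sub_l1_le b b₀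
  have h2 := l2_sq_sub_l2_sq_le b b₀
  have h3 := l1_restr_le S δ
  have h4 := l1_restr_add_compl S δ
  have hc0 := l1_nonneg (restr Sᶜ δ)
  have hl2 := l2_nonneg (restr S δ)
  have hb2 := l2_nonneg b₀
  rw [← hδ, ← hS] at h1 h2
  rw [← hs] at h3
  have h1' := mul_le_mul_of_nonneg_left h1 hlam₁.le
  have h2' := mul_le_mul_of_nonneg_left h2 hlam₂
  have h3' := mul_le_mul_of_nonneg_left h3 hlam₁.le
  set q := (lam₁ * s + 2 * lam₂ * l2 b₀) * l2 (restr S δ) with hq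
  have hA : lam₁ * l1 (restr S δ) ≤ q := by
    have : 0 ≤ lam₂ * l2 b₀ * l2 (restr S δ) := by positivity
    rw [hq]; linarith
  have hB : Ξ + lam₁ * l1 (restr Sᶜ δ) ≤ E + q := by rw [hq]; linarith
  have hC : lam₁ * l1 δ = lam₁ * l1 (restr S δ) + lam₁ * l1 (restr Sᶜ δ) := by
    rw [← h4]; ring
  -- For q ≥ E/2 one has E + q ≤ 3q, which is the source of the factor 3 in the cone. For empty S, q
  -- = 0, so the dummy value of φ is never reached.
  rcases lt_or_ge q (E / 2) with hlt | hge
  · have : 0 ≤ lam₁ * l1 (restr Sᶜ δ) := by positivity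
    constructor <;> linarith
  · have hq0 : 0 < q := by linarith
    have hS0 : 0 < l2 (restr S δ) := by
      rcases hl2.lt_or_eq with h | h
      · exact h
      · rw [hq, ← h, mul_zero] at hq0; exact absurd hq0 (lt_irrefl _)
    have hcone : δ ∈ cone S (adaptiveL lam₁ lam₂ S b₀) := by
      refine ⟨?_, ?_⟩
      · intro h
        rw [h] at hS0
        simp [l2, restr] at hS0
      · have e : adaptiveL lam₁ lam₂ S b₀ * l2 (restr S δ) = 3 * q / lam₁ := by
          rw [adaptiveL, hS, restr_supp, hq, hs, hS]; field_simp
        rw [e, le_div_iff₀ hlam₁]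
        linarith
    obtain ⟨hφ, hφle⟩ := phi_pos_and_mul_le hpos hcone hS0
    set φ := phi N ψ lam₁ lam₂ S b₀ with hφd
    set u := N (lin ψ δ) with hu
    have hu0 : 0 ≤ u := apply_nonneg N _
    have hv : rateArg N ψ lam₁ lam₂ b₀ = (4 * lam₁ * s + 4 * lam₂ * l2 b₀) / φ := rfl
    have hconj' : u * rateArg N ψ lam₁ lam₂ b₀ - G u ≤ E := by
      have := (le_iSup (fun u : {u : ℝ // 0 ≤ u} =>
        (((u : ℝ) * rateArg N ψ lam₁ lam₂ b₀ - G u : ℝ) : EReal)) ⟨u, hu0⟩).trans hconj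
      exact_mod_cast this
    have hqv : 2 * q ≤ u * rateArg N ψ lam₁ lam₂ b₀ := by
      rw [hv, mul_div_assoc', le_div_iff₀ hφ, hq]
      have e1 : 0 ≤ lam₁ * s := by positivity
      have e2 : 0 ≤ lam₂ * l2 b₀ := by positivity
      have e3 := mul_le_mul_of_nonneg_left hφle (show 0 ≤ 4 * lam₁ * s + 4 * lam₂ * l2 b₀ by
        linarith)
      have e4 : 0 ≤ lam₁ * s * (φ * l2 (restr S δ)) := by positivity
      linarith
    rw [← lin_sub, ← hδ, ← hu] at hG
    -- Here 2q ≤ G(u) + E ≤ Ξ + E. Inserting this into Ξ ≤ E + q and λ₁‖δ‖₁ ≤ E + 2q - Ξ gives 3E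
    -- and 2E.
    constructor <;> linarith [mul_nonneg hlam₁.le hc0]

lemma l1_convexComb_le {s t : ℝ} (hs : 0 ≤ s) (ht : 0 ≤ t) (a b : Fin p → ℝ) :
    l1 (s • a + t • b) ≤ s * l1 a + t * l1 b := by
  rw [l1, l1, l1, Finset.mul_sum, Finset.mul_sum, ← Finset.sum_add_distrib]
  refine Finset.sum_le_sum fun j _ => ?_
  have := abs_add_le (s * a j) (t * b j)
  rwa [abs_mul, abs_mul, abs_of_nonneg hs, abs_of_nonneg ht] at this

lemma l2_sq_convexComb_le {s t : ℝ} (hs : 0 ≤ s) (ht : 0 ≤ t) (hst : s + t = 1)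
    (a b : Fin p → ℝ) : l2 (s • a + t • b) ^ 2 ≤ s * l2 a ^ 2 + t * l2 b ^ 2 := by
  rw [l2_sq, l2_sq, l2_sq, Finset.mul_sum, Finset.mul_sum, ← Finset.sum_add_distrib]
  refine Finset.sum_le_sum fun j _ => ?_
  simp only [Pi.add_apply, Pi.smul_apply, smul_eq_mul]
  have ht' : t = 1 - s := by linarith
  subst ht'
  nlinarith [mul_nonneg (mul_nonneg hs ht) (sq_nonneg (a j - b j))]

lemma criterion_convexComb_le {ρ : F → 𝒳 × 𝒴 → ℝ} {Z : Fin n → Ω → 𝒳 × 𝒴}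
    (hρ : ∀ z, ConvexOn ℝ Set.univ (fun f : F => ρ f z)) (ψ : Fin p → F) {lam₁ lam₂ : ℝ}
    (hlam₁ : 0 ≤ lam₁) (hlam₂ : 0 ≤ lam₂) {s t : ℝ} (hs : 0 ≤ s) (ht : 0 ≤ t) (hst : s + t = 1)
    (a b : Fin p → ℝ) (ω : Ω) :
    criterion ρ Z ψ lam₁ lam₂ (s • a + t • b) ω
      ≤ s * criterion ρ Z ψ lam₁ lam₂ a ω + t * criterion ρ Z ψ lam₁ lam₂ b ω := by
  have h1 := mul_le_mul_of_nonneg_left (l1_convexComb_le hs ht a b) hlam₁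
  have h2 := mul_le_mul_of_nonneg_left (l2_sq_convexComb_le hs ht hst a b) hlam₂
  have h3 : empRisk ρ Z (lin ψ (s • a + t • b)) ω
      ≤ s * empRisk ρ Z (lin ψ a) ω + t * empRisk ρ Z (lin ψ b) ω := by
    have h4 : ∑ i, ρ (lin ψ (s • a + t • b)) (Z i ω)
        ≤ ∑ i, (s * ρ (lin ψ a) (Z i ω) + t * ρ (lin ψ b) (Z i ω)) :=
      Finset.sum_le_sum fun i _ => by
        rw [lin_convexComb]
        simpa using (hρ (Z i ω)).2 (Set.mem_univ (lin ψ a)) (Set.mem_univ (lin ψ b)) hs ht hst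
    have h5 := mul_le_mul_of_nonneg_left h4 (show 0 ≤ 1 / (n : ℝ) by positivity)
    rw [Finset.sum_add_distrib, ← Finset.mul_sum, ← Finset.mul_sum] at h5
    simp only [empRisk]
    linarith
  simp only [criterion]
  linarith

/-- The oracle inequality on the event where the empirical process is bounded by `λ₀ M` over the
`ℓ₁`-ball of radius `M`. -/
theorem oracle_inequality [MeasurableSpace Ω] {μ : Measure Ω} {ρ : F → 𝒳 × 𝒴 → ℝ}
    {Z : Fin n → Ω → 𝒳 × 𝒴} {N : Seminorm ℝ F} {ψ : Fin p → F} {Φ : Set (Fin p → ℝ)}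
    {η lam₀ lam₁ lam₂ M : ℝ} {G : ℝ → ℝ} {b₀ b : Fin p → ℝ} {ω : Ω}
    (hρ : ∀ z, ConvexOn ℝ Set.univ (fun f : F => ρ f z)) (hΦ : Convex ℝ Φ) (hb₀ : b₀ ∈ Φ)
    (htarget : IsTarget μ ρ Z (lin ψ b₀)) (hlam₀ : 0 < lam₀) (hlam₁ : 8 * lam₀ ≤ lam₁)
    (hlam₂ : 0 ≤ lam₂) (hmargin : MarginCondition μ ρ Z N (lin ψ b₀) η G)
    (hpos : RestrictedEigenvalue N ψ lam₁ lam₂ b₀) (hM : 0 < M)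
    (hlocal : ∀ b ∈ Φ, l1 (b - b₀) ≤ M → lin ψ b ∈ localSet (lin ψ b₀) η)
    (hconj : conj G (rateArg N ψ lam₁ lam₂ b₀) ≤ ((lam₀ * M : ℝ) : EReal))
    (hevent : ∀ b ∈ Φ, l1 (b - b₀) ≤ M →
      risk μ ρ Z (lin ψ b) - risk μ ρ Z (lin ψ b₀)
        - (empRisk ρ Z (lin ψ b) ω - empRisk ρ Z (lin ψ b₀) ω) ≤ lam₀ * M)
    (hb : IsElasticNet ρ Z ψ Φ lam₁ lam₂ b ω) :
    lam₁ * l1 (b - b₀) ≤ 2 * (lam₀ * M) ∧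
      excess μ ρ Z (lin ψ b₀) (lin ψ b) ≤ 3 * (lam₀ * M) := by
  have hl1 : 0 < lam₁ := by linarith
  have hcrit := hb.2 b₀ hb₀
  have step : ∀ a ∈ Φ, l1 (a - b₀) ≤ M →
      criterion ρ Z ψ lam₁ lam₂ a ω ≤ criterion ρ Z ψ lam₁ lam₂ b₀ ω →
      lam₁ * l1 (a - b₀) ≤ 2 * (lam₀ * M) ∧
        excess μ ρ Z (lin ψ b₀) (lin ψ a) ≤ 3 * (lam₀ * M) := by
    intro a ha haM hac
    refine basic_inequality_consequence hl1 hlam₂ (by positivity)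
      (sub_nonneg.2 (htarget _)) hpos hconj (hmargin.2.2 _ (hlocal a ha haM)) ?_
    have := hevent a ha haM
    simp only [criterion] at hac
    simp only [excess]
    linarith
  set r := l1 (b - b₀) with hr
  have hr0 : 0 ≤ r := l1_nonneg _
  -- This weight puts the shrunken point at distance tr ≤ M from b₀.
  set t := M / (M + r) with ht
  have ht0 : 0 ≤ t := by positivity
  have ht1 : t ≤ 1 := (div_le_one (by positivity)).2 (by linarith)
  have htr : t * (M + r) = M := div_mul_cancel₀ _ (by positivity)
  set a := t • b + (1 - t) • b₀ with ha
  have haΦ : a ∈ Φ := hΦ hb.1 hb₀ ht0 (by linarith) (by ring)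
  have hdist : l1 (a - b₀) = t * r := by
    have : a - b₀ = t • (b - b₀) := by
      rw [ha]; module
    rw [this, l1_smul, abs_of_nonneg ht0]
  have hcomb := criterion_convexComb_le (Z := Z) hρ ψ hl1.le hlam₂ ht0 (sub_nonneg.2 ht1)
    (by ring) b b₀ ω
  rw [← ha] at hcomb
  have h1 := (step a haΦ (by rw [hdist]; nlinarith) (by nlinarith)).1
  rw [hdist] at h1
  have h2 : 4 * (t * r) ≤ M := by
    have h3 := mul_le_mul_of_nonneg_right hlam₁ (show 0 ≤ t * r by positivity)
    have h4 : lam₀ * (4 * (t * r)) ≤ lam₀ * M := by linarith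
    exact le_of_mul_le_mul_left h4 hlam₀
  -- From 4tr ≤ M = t(M + r) follows 3r ≤ M, so the estimator itself lies in the ball.
  have h5 : r ≤ M := by
    have h6 : t * (3 * r) ≤ t * M := by linarith
    have h7 : 0 < t := by positivity
    linarith [le_of_mul_le_mul_left h6 h7]
  exact step b hb.1 h5 hcrit

end Oracle

/-! ### Events of high probability -/

section Events

variable {Ω : Type*} [MeasurableSpace Ω] {μ : Measure Ω} {q : ℝ}

lemma HoldsWithProb.mono {P Q : Ω → Prop} (h : HoldsWithProb μ q P) (hPQ : ∀ ω, P ω → Q ω) :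
    HoldsWithProb μ q Q := by
  obtain ⟨A, hA, hq, hP⟩ := h
  exact ⟨A, hA, hq, fun ω hω => hPQ ω (hP ω hω)⟩

/-- The exceptional set need not be measurable, so a measurable null superset is removed. -/
lemma HoldsWithProb.and_ae {P Q : Ω → Prop} (h : HoldsWithProb μ q P) (hQ : ∀ᵐ ω ∂μ, Q ω) :
    HoldsWithProb μ q fun ω => P ω ∧ Q ω := by
  obtain ⟨A, hA, hq, hP⟩ := h
  obtain ⟨B, hQB, hB, hB0⟩ := exists_measurable_superset_of_null (ae_iff.1 hQ)
  refine ⟨A \ B, hA.diff hB, ?_, fun ω hω => ⟨hP ω hω.1, ?_⟩⟩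
  · rwa [measureReal_def, measure_sdiff_null hB0]
  · by_contra hn
    exact hω.2 (hQB hn)

/-- A decreasing sequence of properties, each holding with probability at least `q`, holds
simultaneously with probability at least `q`. -/
lemma HoldsWithProb.forall_of_antitone [IsFiniteMeasure μ] {P : ℕ → Ω → Prop}
    (hanti : ∀ ω k l, k ≤ l → P l ω → P k ω) (h : ∀ k, HoldsWithProb μ q (P k)) :
    HoldsWithProb μ q fun ω => ∀ k, P k ω := by
  choose A hA hq hP using h
  -- The events themselves need not be nested, so their limit superior is used; a point in it
  -- satisfies P l for arbitrarily large l.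
  let B : ℕ → Set Ω := fun N => ⋃ k : {k // N ≤ k}, A k
  have hB : ∀ N, MeasurableSet (B N) := fun N => MeasurableSet.iUnion fun k => hA k
  have hBanti : Antitone B := fun N N' hN ω hω => by
    obtain ⟨⟨k, hk⟩, hωk⟩ := Set.mem_iUnion.1 hω
    exact Set.mem_iUnion.2 ⟨⟨k, hN.trans hk⟩, hωk⟩
  refine ⟨⋂ N, B N, MeasurableSet.iInter hB, ?_, fun ω hω k => ?_⟩
  · have ht := tendsto_measure_iInter_atTop (μ := μ) (fun N => (hB N).nullMeasurableSet) hBanti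
      ⟨0, measure_ne_top _ _⟩
    refine ge_of_tendsto' ((ENNReal.tendsto_toReal (measure_ne_top μ (⋂ N, B N))).comp ht)
      fun N => (hq N).trans ?_
    exact measureReal_mono (Set.subset_iUnion (fun k : {k // N ≤ k} => A k) ⟨N, le_rfl⟩)
  · obtain ⟨⟨l, hl⟩, hωl⟩ := Set.mem_iUnion.1 (Set.mem_iInter.1 hω k)
    exact hanti ω k l hl (hP l ω hωl)

end Events

/-! ### Bounds on the convex conjugate. -/

section Conjugate

lemma conj_nonneg {G : ℝ → ℝ} (h0 : G 0 = 0) (v : ℝ) : 0 ≤ conj G v := by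
  have := le_iSup (fun u : {u : ℝ // 0 ≤ u} => (((u : ℝ) * v - G u : ℝ) : EReal)) ⟨0, le_rfl⟩
  refine le_trans ?_ this
  simp [h0]

/-- Completing the square; part b) needs only this direction. -/
lemma conj_quadratic_le {G : ℝ → ℝ} {c : ℝ} (hc : 0 < c) (hG : ∀ u, 0 ≤ u → G u = c * u ^ 2)
    (v : ℝ) : conj G v ≤ ((v ^ 2 / (4 * c) : ℝ) : EReal) := by
  refine iSup_le fun ⟨u, hu⟩ => EReal.coe_le_coe_iff.2 ?_
  rw [hG u hu, le_div_iff₀ (by positivity)]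
  nlinarith [sq_nonneg (2 * c * u - v)]

end Conjugate

/-! ### Locality of small balls and the empirical process with explicit constants. -/

section Main

/-- The sup-norm bound on the basis makes small ℓ₁-balls local. This serves the case H = 0, where
the assumed locality concerns only radius zero. -/
lemma mem_localSet_of_l1_le {𝒳 : Type*} {p : ℕ} {F : Submodule ℝ (𝒳 → ℝ)} {ψ : Fin p → F} {K η : ℝ} (hK : 0 < K)
    (hψK : ∀ j x, |(ψ j : 𝒳 → ℝ) x| ≤ K) {b₀ b : Fin p → ℝ} (h : l1 (b - b₀) ≤ η / K) :
    lin ψ b ∈ localSet (lin ψ b₀) η := by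
  intro x
  have e : (lin ψ b : 𝒳 → ℝ) x - (lin ψ b₀ : 𝒳 → ℝ) x
      = ∑ j, (b - b₀) j * (ψ j : 𝒳 → ℝ) x := by
    rw [← lin_apply, lin_sub]; rfl
  rw [e]
  exact (abs_sum_mul_le fun j => hψK j x).trans ((le_div_iff₀ hK).1 h)

variable {Ω 𝒳 : Type*} [MeasurableSpace Ω] [MeasurableSpace 𝒳] {𝒴 : Set ℝ} {n p : ℕ}
  {F : Submodule ℝ (𝒳 → ℝ)}

lemma lamZero_pos {d D : ℝ} (hd : 0 < d) (hD : 0 < D) (hp : 2 ≤ p) (hpn : Real.log p ≤ n) :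
    0 < lamZero d D n p := by
  have hlog : 0 < Real.log p := Real.log_pos (by exact_mod_cast hp)
  have hn : (0 : ℝ) < n := hlog.trans_le hpn
  exact mul_pos (mul_pos hd hD) (Real.sqrt_pos.2 (div_pos hlog hn))

/-- With `d = 5 K`, the empirical process over the `ℓ₁`-ball of radius `M` is at most `λ₀ M` with
probability at least `1 - 1 / p`. -/
theorem holdsWithProb_empirical_process {μ : Measure Ω} [IsProbabilityMeasure μ]
    {Z : Fin n → Ω → 𝒳 × 𝒴} (hZ : ∀ i, Measurable (Z i)) (hind : iIndepFun Z μ)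
    {ρ : F → 𝒳 × 𝒴 → ℝ} (hρm : ∀ f, Measurable (ρ f))
    (hρi : ∀ f i, Integrable (fun ω => ρ f (Z i ω)) μ)
    {ψ : Fin p → F} (hψ : ∀ j, Measurable (ψ j : 𝒳 → ℝ)) {Φ : Set (Fin p → ℝ)}
    {γ : 𝒴 → ℝ → ℝ} {cst : F → ℝ} (hγ : ∀ f x y, ρ f (x, y) = γ y ((f : 𝒳 → ℝ) x) + cst f)
    {D K M : ℝ} (hD : 0 < D) (hK : 0 < K) (hM : 0 < M)
    (hlip : ∀ (x : 𝒳) (y : 𝒴), ∀ β ∈ Φ, ∀ b ∈ Φ,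
      |γ y ((lin ψ β : 𝒳 → ℝ) x) - γ y ((lin ψ b : 𝒳 → ℝ) x)|
        ≤ D * |(lin ψ β : 𝒳 → ℝ) x - (lin ψ b : 𝒳 → ℝ) x|)
    (hψK : ∀ j x, |(ψ j : 𝒳 → ℝ) x| ≤ K) (hp : 2 ≤ p) (hpn : Real.log p ≤ n)
    {b₀ : Fin p → ℝ} (hb₀ : b₀ ∈ Φ) :
    HoldsWithProb μ (1 - 1 / (p : ℝ)) fun ω => ∀ b ∈ Φ, l1 (b - b₀) ≤ M →
      risk μ ρ Z (lin ψ b) - risk μ ρ Z (lin ψ b₀)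
        - (empRisk ρ Z (lin ψ b) ω - empRisk ρ Z (lin ψ b₀) ω) ≤ lamZero (5 * K) D n p * M := by
  have hlog : 0 < Real.log p := Real.log_pos (by exact_mod_cast hp)
  have hn : (0 : ℝ) < n := hlog.trans_le hpn
  have hp2 : (2 : ℝ) ≤ p := by exact_mod_cast hp
  have hlam := lamZero_pos (n := n) (mul_pos (show (0 : ℝ) < 5 by norm_num) hK) hD hp hpn
  have : Nonempty (Fin p) := ⟨⟨0, by omega⟩⟩
  obtain ⟨A, hA, hq, hAb⟩ := exists_event_sum_centered_le (S := 𝒳 × 𝒴) hZ hind hD hK hM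
    (mul_pos hlam hM)
    (ψ := fun j z => (ψ j : 𝒳 → ℝ) z.1) (fun j => (hψ j).comp measurable_fst)
    (fun j z => hψK j z.1) hb₀
    -- Removing the constants leaves a difference of γ-terms, to which the Lipschitz condition
    -- applies; they cancel under centring.
    (g := fun b z => ρ (lin ψ b) z - cst (lin ψ b) - (ρ (lin ψ b₀) z - cst (lin ψ b₀)))
    (fun b => ((hρm _).sub_const _).sub ((hρm _).sub_const _)) (fun z => by ring)
    (by
      rintro ⟨x, y⟩ a ha b hb
      have e : ∑ j, (a - b) j * (ψ j : 𝒳 → ℝ) x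
          = (lin ψ a : 𝒳 → ℝ) x - (lin ψ b : 𝒳 → ℝ) x := by
        rw [← lin_apply, lin_sub]; rfl
      rw [e]
      refine le_trans (le_of_eq ?_) (hlip x y a ha b hb)
      rw [hγ, hγ, hγ]
      congr 1
      ring)
  refine ⟨A, hA, le_trans ?_ hq, fun ω hω b hb hbM => ?_⟩
  · have e1 : (n : ℝ) * (lamZero (5 * K) D n p * M) ^ 2 / (8 * (D * K * M) ^ 2)
        = 25 / 8 * Real.log p := by
      rw [lamZero, mul_pow, mul_pow, Real.sq_sqrt (by positivity)]
      field_simp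
      ring
    have e2 : Real.exp (-(25 / 8 * Real.log p)) ≤ 1 / (p : ℝ) ^ 3 := by
      have : (1 : ℝ) / (p : ℝ) ^ 3 = Real.exp (-(3 * Real.log p)) := by
        rw [Real.exp_neg, one_div]
        congr 1
        rw [← Real.exp_log (show (0 : ℝ) < p by linarith), ← Real.exp_nat_mul, Real.log_exp]
        norm_num
      rw [this]
      exact Real.exp_le_exp.2 (by linarith)
    -- An exponent of at least 3 leaves 2/p² ≤ 1/p, because p ≥ 2.
    have e3 : 2 * (p : ℝ) * (1 / (p : ℝ) ^ 3) ≤ 1 / p := by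
      rw [mul_one_div, div_le_div_iff₀ (by positivity) (by positivity)]
      nlinarith [mul_nonneg (sq_nonneg (p : ℝ)) (sub_nonneg.2 hp2)]
    rw [e1]
    have e4 := mul_le_mul_of_nonneg_left e2 (show 0 ≤ 2 * (p : ℝ) by positivity)
    linarith
  · have h1 := hAb ω hω b hb hbM
    have h2 : ∀ i, ∫ ω', (ρ (lin ψ b) (Z i ω') - cst (lin ψ b)
          - (ρ (lin ψ b₀) (Z i ω') - cst (lin ψ b₀))) ∂μ
        = ∫ ω', ρ (lin ψ b) (Z i ω') ∂μ - cst (lin ψ b)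
          - (∫ ω', ρ (lin ψ b₀) (Z i ω') ∂μ - cst (lin ψ b₀)) := by
      intro i
      have hi : ∀ f, Integrable (fun ω' => ρ f (Z i ω') - cst f) μ := fun f =>
        (hρi f i).sub (integrable_const _)
      rw [integral_sub (hi _) (hi _), integral_sub (hρi _ i) (integrable_const _),
        integral_sub (hρi _ i) (integrable_const _)]
      simp
    have h3 : ∑ i, (∫ ω', (ρ (lin ψ b) (Z i ω') - cst (lin ψ b)
          - (ρ (lin ψ b₀) (Z i ω') - cst (lin ψ b₀))) ∂μ
          - (ρ (lin ψ b) (Z i ω) - cst (lin ψ b) - (ρ (lin ψ b₀) (Z i ω) - cst (lin ψ b₀))))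
        = n * (risk μ ρ Z (lin ψ b) - risk μ ρ Z (lin ψ b₀)
          - (empRisk ρ Z (lin ψ b) ω - empRisk ρ Z (lin ψ b₀) ω)) := by
      simp only [h2, risk, empRisk, Finset.sum_sub_distrib]
      field_simp
      ring
    rw [h3] at h1
    exact le_of_mul_le_mul_left h1 hn

end Main

end ElasticNet

end

/-! ### Assembly of the two parts. -/

theorem corollary2 (K : ℝ) (hK : 0 < K) :
    ∃ d : ℝ, 0 < d ∧
      ∀ (n p : ℕ) (Ω : Type*) [MeasurableSpace Ω] (μ : Measure Ω) [IsProbabilityMeasure μ]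
        (𝒳 : Type*) [MeasurableSpace 𝒳] (𝒴 : Set ℝ)
        -- the independent sample
        (Z : Fin n → Ω → 𝒳 × 𝒴) (_ : ∀ i, Measurable (Z i)) (_ : iIndepFun Z μ)
        -- the function space with its norm, and the convex loss
        (F : Submodule ℝ (𝒳 → ℝ)) (N : Seminorm ℝ F) (ρ : F → 𝒳 × 𝒴 → ℝ)
        (_ : ∀ f, Measurable (ρ f)) (_ : ∀ f i, Integrable (fun ω => ρ f (Z i ω)) μ)
        (_ : ∀ z, ConvexOn ℝ Set.univ (fun f : F => ρ f z))
        -- the basis functions and the parameter set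
        (ψ : Fin p → F) (_ : ∀ j, Measurable (ψ j : 𝒳 → ℝ))
        (Φ : Set (Fin p → ℝ)) (_ : Convex ℝ Φ)
        -- the loss is `γ(y, f(x)) + c(f)`, with `γ` Lipschitz over the linear functions
        (γ : 𝒴 → ℝ → ℝ) (cst : F → ℝ) (_ : ∀ f x y, ρ f (x, y) = γ y ((f : 𝒳 → ℝ) x) + cst f)
        (D : ℝ) (_ : 0 < D)
        (_ : ∀ (x : 𝒳) (y : 𝒴), ∀ β ∈ Φ, ∀ b ∈ Φ,
          |γ y ((lin ψ β : 𝒳 → ℝ) x) - γ y ((lin ψ b : 𝒳 → ℝ) x)|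
            ≤ D * |(lin ψ β : 𝒳 → ℝ) x - (lin ψ b : 𝒳 → ℝ) x|)
        -- moment and sup-norm bounds on the basis functions
        (_ : (1 / (n : ℝ)) * ∑ i, (⨆ j, ∫ ω, (ψ j : 𝒳 → ℝ) (Z i ω).1 ^ 2 ∂μ) ≤ 1)
        (_ : ∀ j x, |(ψ j : 𝒳 → ℝ) x| ≤ K)
        (_ : 2 ≤ p) (_ : Real.log p ≤ n)
        -- the target is linear
        (β₀ : Fin p → ℝ) (_ : β₀ ∈ Φ) (_ : IsTarget μ ρ Z (lin ψ β₀))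
        -- the tuning parameters
        (lam₁ lam₂ : ℝ) (_ : 8 * lamZero d D n p ≤ lam₁) (_ : 0 ≤ lam₂)
        -- margin, locality and restricted eigenvalue conditions, with the oracle at `β₀`
        (η : ℝ) (_ : 0 < η) (G : ℝ → ℝ) (_ : MarginCondition μ ρ Z N (lin ψ β₀) η G)
        (_ : LocalCondition μ ρ Z N ψ Φ (lin ψ β₀) η G (lamZero d D n p) lam₁ lam₂ β₀)
        (_ : RestrictedEigenvalue N ψ lam₁ lam₂ β₀)
        -- the elastic net estimator
        (βhat : Ω → Fin p → ℝ) (_ : ∀ᵐ ω ∂μ, IsElasticNet ρ Z ψ Φ lam₁ lam₂ (βhat ω) ω),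
        -- part a)
        HoldsWithProb μ (1 - 1 / (p : ℝ)) (fun ω =>
          ((excess μ ρ Z (lin ψ β₀) (lin ψ (βhat ω)) : ℝ) : EReal)
              ≤ ((4 : ℝ) : EReal) * conj G
                ((4 * lam₁ * √((supp β₀).card : ℝ) + 4 * lam₂ * l2 β₀)
                  / phi N ψ lam₁ lam₂ (supp β₀) β₀) ∧
          ((l1 (βhat ω - β₀) : ℝ) : EReal)
              ≤ ((4 / lam₁ : ℝ) : EReal) * conj G
                ((4 * lam₁ * √((supp β₀).card : ℝ) + 4 * lam₂ * l2 β₀)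
                  / phi N ψ lam₁ lam₂ (supp β₀) β₀)) ∧
        -- part b)
        ∀ c L : ℝ, 0 < c → (∀ u, 0 ≤ u → G u = c * u ^ 2) → 8 ≤ L → β₀ ≠ 0 →
          lam₂ = lam₁ * √((supp β₀).card : ℝ) / (2 * l2 β₀) →
          lam₁ ≤ L * lamZero d D n p →
          HoldsWithProb μ (1 - 1 / (p : ℝ)) (fun ω =>
            (excess μ ρ Z (lin ψ β₀) (lin ψ (βhat ω))
                ≤ 36 / c * (lam₁ ^ 2 * (supp β₀).card
                    / phi N ψ lam₁ lam₂ (supp β₀) β₀ ^ 2) ∧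
              36 / c * (lam₁ ^ 2 * (supp β₀).card / phi N ψ lam₁ lam₂ (supp β₀) β₀ ^ 2)
                ≤ 36 / c * ((L * d * D) ^ 2 * Real.log p * (supp β₀).card
                    / (n * phi N ψ lam₁ lam₂ (supp β₀) β₀ ^ 2))) ∧
            (l1 (βhat ω - β₀)
                ≤ 36 / c * (lam₁ * (supp β₀).card / phi N ψ lam₁ lam₂ (supp β₀) β₀ ^ 2) ∧
              36 / c * (lam₁ * (supp β₀).card / phi N ψ lam₁ lam₂ (supp β₀) β₀ ^ 2)
                ≤ 36 * L * d * D / c * √(Real.log p / n)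
                    * ((supp β₀).card / phi N ψ lam₁ lam₂ (supp β₀) β₀ ^ 2))) := by
  -- The tail exponent is d²/(8K²) · log p, and 25/8 ≥ 3.
  refine ⟨5 * K, by positivity, ?_⟩
  intro n p Ω _ μ _ 𝒳 _ 𝒴 Z hZ hind F N ρ hρm hρi hρc ψ hψ Φ hΦ γ cst hγ D hD hlip _ hψK hp hpn
    β₀ hβ₀ htarget lam₁ lam₂ hlam₁ hlam₂ η hη G hmargin hlocal hpos βhat hβhat
  have hlam₀ := lamZero_pos (n := n) (mul_pos (show (0 : ℝ) < 5 by norm_num) hK) hD hp hpn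
  set lam₀ := lamZero (5 * K) D n p with hlam₀_def
  have hlam₁_pos : 0 < lam₁ := by linarith
  set H := conj G (rateArg N ψ lam₁ lam₂ β₀) with hH
  have hH0 : 0 ≤ H := conj_nonneg hmargin.2.1 _
  have hball : ∀ M : ℝ, 0 < M → (∀ b ∈ Φ, l1 (b - β₀) ≤ M → lin ψ b ∈ localSet (lin ψ β₀) η) →
      H ≤ ((lam₀ * M : ℝ) : EReal) →
      HoldsWithProb μ (1 - 1 / (p : ℝ)) fun ω =>
        lam₁ * l1 (βhat ω - β₀) ≤ 2 * (lam₀ * M) ∧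
          excess μ ρ Z (lin ψ β₀) (lin ψ (βhat ω)) ≤ 3 * (lam₀ * M) := by
    intro M hM hloc hHM
    refine ((holdsWithProb_empirical_process hZ hind hρm hρi hψ hγ hD hK hM hlip hψK hp hpn
      hβ₀).and_ae hβhat).mono fun ω hω => ?_
    exact oracle_inequality hρc hΦ hβ₀ htarget hlam₀ hlam₁ hlam₂ hmargin hpos hM hloc hHM hω.1 hω.2
  have parta : HoldsWithProb μ (1 - 1 / (p : ℝ)) (fun ω =>
      ((excess μ ρ Z (lin ψ β₀) (lin ψ (βhat ω)) : ℝ) : EReal) ≤ ((4 : ℝ) : EReal) * H ∧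
        ((l1 (βhat ω - β₀) : ℝ) : EReal) ≤ ((4 / lam₁ : ℝ) : EReal) * H) := by
    rcases eq_or_ne H ⊤ with htop | htop
    · refine ⟨Set.univ, MeasurableSet.univ, ?_, fun ω _ => ?_⟩
      · simp
      · rw [htop, EReal.coe_mul_top_of_pos (by norm_num), EReal.coe_mul_top_of_pos (by positivity)]
        exact ⟨le_top, le_top⟩
    obtain ⟨h, hh⟩ : ∃ h : ℝ, H = (h : EReal) :=
      ⟨H.toReal, (EReal.coe_toReal htop (ne_bot_of_le_ne_bot EReal.zero_ne_bot hH0)).symm⟩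
    have hh0 : 0 ≤ h := by
      rw [hh] at hH0; exact_mod_cast hH0
    suffices hreal : HoldsWithProb μ (1 - 1 / (p : ℝ)) (fun ω =>
        lam₁ * l1 (βhat ω - β₀) ≤ 2 * h ∧
          excess μ ρ Z (lin ψ β₀) (lin ψ (βhat ω)) ≤ 3 * h) by
      refine hreal.mono fun ω hω => ?_
      rw [hh, ← EReal.coe_mul, ← EReal.coe_mul, EReal.coe_le_coe_iff, EReal.coe_le_coe_iff]
      refine ⟨by linarith [hω.2], ?_⟩
      rw [div_mul_eq_mul_div, le_div_iff₀ hlam₁_pos]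
      linarith [hω.1]
    rcases hh0.lt_or_eq with hpos_h | hzero
    · have hM : lam₀ * (h / lam₀) = h := mul_div_cancel₀ _ hlam₀.ne'
      have := hball (h / lam₀) (by positivity) (fun b hb hbM => hlocal.2 b hb ?_)
        (by rw [hM, hh])
      · rwa [hM] at this
      · have e : oracleBound μ ρ Z N ψ (lin ψ β₀) G lam₁ lam₂ β₀ = H := by
          simp [oracleBound, excess, hH]
        rw [e, hh, ← EReal.coe_div]
        exact EReal.coe_le_coe_iff.2 hbM
    · subst hzero
      -- The deviation bound needs a positive radius, so H = 0 is reached by letting the radii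
      -- shrink to zero.
      let M : ℕ → ℝ := fun k => η / K / (k + 1)
      have hMpos : ∀ k, 0 < M k := fun k => by positivity
      have hMle : ∀ k, M k ≤ η / K := fun k =>
        div_le_self (by positivity) (by linarith [Nat.cast_nonneg (α := ℝ) k])
      have hMlim : Filter.Tendsto M Filter.atTop (nhds 0) :=
        (tendsto_const_div_atTop_nhds_zero_nat (η / K)).comp (Filter.tendsto_add_atTop_nat 1)
          |>.congr fun k => by simp [M]
      have := HoldsWithProb.forall_of_antitone (fun ω k l hkl hω => ?_) fun k =>
        hball (M k) (hMpos k)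
          (fun b _ hbM => mem_localSet_of_l1_le hK hψK (hbM.trans (hMle k)))
          (by rw [hh]; exact EReal.coe_le_coe_iff.2 (mul_pos hlam₀ (hMpos k)).le)
      · refine this.mono fun ω hω => ⟨?_, ?_⟩
        · exact ge_of_tendsto' ((hMlim.const_mul lam₀).const_mul 2 |>.congr fun _ => rfl)
            (fun k => (hω k).1) |>.trans (by simp)
        · exact ge_of_tendsto' ((hMlim.const_mul lam₀).const_mul 3 |>.congr fun _ => rfl)
            (fun k => (hω k).2) |>.trans (by simp)
      · have hkl' : M l ≤ M k :=
          div_le_div_of_nonneg_left (by positivity) (by positivity)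
            (by have : (k : ℝ) ≤ l := by exact_mod_cast hkl
                linarith)
        have := mul_le_mul_of_nonneg_left hkl' hlam₀.le
        exact ⟨hω.1.trans (by linarith), hω.2.trans (by linarith)⟩
  refine ⟨parta, fun c L hc hG hL hβ₀_ne hlam₂_eq hlam₁_le => ?_⟩
  refine parta.mono fun ω hω => ?_
  set s : ℝ := ((supp β₀).card : ℝ) with hs
  set φ := phi N ψ lam₁ lam₂ (supp β₀) β₀ with hφ
  have hs0 : 0 ≤ s := Nat.cast_nonneg _
  have hl2 : l2 β₀ ≠ 0 := by
    intro h0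
    have h1 : ∑ j, β₀ j ^ 2 = 0 := by rw [← l2_sq, h0]; ring
    refine hβ₀_ne (funext fun j => ?_)
    have := (Finset.sum_eq_zero_iff_of_nonneg fun j _ => sq_nonneg (β₀ j)).1 h1 j
      (Finset.mem_univ j)
    exact pow_eq_zero_iff (two_ne_zero) |>.1 this
  -- The choice of λ₂ makes the ridge term contribute 2λ₁√s to the existing 4λ₁√s. Hence H ≤
  -- 36λ₁²s/(4cφ²), and the factor 4 of part a) restores 36.
  have hrate : rateArg N ψ lam₁ lam₂ β₀ = 6 * lam₁ * √s / φ := by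
    have : lam₂ * l2 β₀ = lam₁ * √s / 2 := by
      rw [hlam₂_eq]; field_simp
    have e : 4 * lam₁ * √s + 4 * lam₂ * l2 β₀ = 6 * lam₁ * √s := by linarith
    rw [rateArg, ← hs, ← hφ, e]
  have hHle : H ≤ ((9 / c * (lam₁ ^ 2 * s / φ ^ 2) : ℝ) : EReal) := by
    refine (conj_quadratic_le hc hG _).trans (EReal.coe_le_coe_iff.2 (le_of_eq ?_))
    rw [hrate, div_pow, mul_pow, mul_pow, Real.sq_sqrt hs0]
    ring
  have hmul : ∀ a : ℝ, 0 ≤ a → ((a : ℝ) : EReal) * H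
      ≤ ((a * (9 / c * (lam₁ ^ 2 * s / φ ^ 2)) : ℝ) : EReal) := fun a ha => by
    rw [EReal.coe_mul]
    exact mul_le_mul_of_nonneg_left hHle (EReal.coe_nonneg.2 ha)
  have h1 := EReal.coe_le_coe_iff.1 (hω.1.trans (hmul 4 (by norm_num)))
  have h2 := EReal.coe_le_coe_iff.1 (hω.2.trans (hmul (4 / lam₁) (by positivity)))
  have hn : (0 : ℝ) ≤ Real.log p / n :=
    div_nonneg (Real.log_nonneg (by exact_mod_cast (by omega : 1 ≤ p))) (Nat.cast_nonneg n)
  have hlam_eq : L * lam₀ = L * (5 * K) * D * √(Real.log p / n) := by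
    rw [hlam₀_def, lamZero]; ring
  refine ⟨⟨h1.trans (le_of_eq (by ring)), ?_⟩, h2.trans (le_of_eq ?_), ?_⟩
  · have h3 : lam₁ ^ 2 ≤ (L * (5 * K) * D) ^ 2 * (Real.log p / n) := by
      rw [← Real.sq_sqrt hn, ← mul_pow, ← hlam_eq]
      exact pow_le_pow_left₀ hlam₁_pos.le hlam₁_le 2
    have h4 := mul_le_mul_of_nonneg_right h3 (show 0 ≤ s / φ ^ 2 by positivity)
    refine mul_le_mul_of_nonneg_left ?_ (by positivity)
    calc lam₁ ^ 2 * s / φ ^ 2 = lam₁ ^ 2 * (s / φ ^ 2) := by ring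
      _ ≤ _ := h4
      _ = _ := by ring
  · field_simp
    ring
  · have h4 := mul_le_mul_of_nonneg_right (hlam_eq ▸ hlam₁_le) (show 0 ≤ s / φ ^ 2 by positivity)
    have h5 := mul_le_mul_of_nonneg_left h4 (show 0 ≤ 36 / c by positivity)
    calc 36 / c * (lam₁ * s / φ ^ 2) = 36 / c * (lam₁ * (s / φ ^ 2)) := by ring
      _ ≤ _ := h5
      _ = _ := by ring
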